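/- Conventions. A plane graph is a finite graph without self-loops (parallel edges allowed, disconnected graphs allowed) with a fixed embedding in the Euclidean plane; its faces are the connected components of the complement of the drawing, and the outer face is the unbounded one. The radial completion $H=H_G$ of a plane graph $G$ is the graph obtained from $G$ by adding one vertex $v_f$ for every face $f$ of $G$, drawn inside $f$, and joining $v_f$ by an edge to every vertex of $G$ on the boundary of $f$; it is drawn in the plane so that the drawing extends that of $G$. A sequence $(C_1,\dots,C_t)$ of cycles of $G$ (two parallel edges form a cycle) is concentric if $C_i$ is drawn in the strict interior of $C_{i+1}$ for every $1\le i<t$; it is $U$-free, for $U\subseteq V(G)$, if no vertex of $U$ is drawn in the strict interior of $C_t$. An instance $(G,S,T,g,k)$ of Planar Disjoint Paths consists of a plane graph $G$, sets $S,T\subseteq V(G)$ with $|S|=k$, and a bijection $g:S\to T$. Let $c\ge 1$ be a constant. The instance is good if (i) every vertex of $S\cup T$ has degree $1$ in $G$ and $S\cap T=\emptyset$; (ii) some $t^\star\in T$ lies on the outer face of $G$ and on the outer face of $H$, for a suitable drawing of $H$ as above; (iii) the treewidth of $G$ is at most $2^{ck}$; and (iv) $G$ has no $(S\cup T)$-free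 sequence of concentric cycles of length larger than $2^{ck}$. A Steiner tree is a subtree of $H$ whose set of leaves (vertices of degree $1$ in the tree) is precisely $S\cup T$. Lemma. Let $(G,S,T,g,k)$ be a good instance of Planar Disjoint Paths, let $H$ be the radial completion of $G$, and let $R'$ be a Steiner tree. Then every vertex $v\in V(H)$ satisfies $\mathrm{dist}_H(v,V(R'))\le 4\cdot 2^{ck}$, i.e. some vertex $w$ of $R'$ is at distance at most $4\cdot 2^{ck}$ from $v$ in $H$. -/

import Mathlib

/-- A plane graph with vertices `V` and edges `E`: a graph without self-loops, parallel edges being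
allowed, together with a fixed embedding in the Euclidean plane (here `ℂ`). Vertices are mapped to
distinct points and every edge to a simple curve between the points of its two ends; the curves are
disjoint from each other and from the vertices except at their extreme points. The order of the two
ends `src e`, `tgt e` only records the direction in which the curve of `e` is parametrised; the
graph is undirected. -/
structure PlaneGraph (V E : Type*) where
  pos : V → ℂ
  src : E → V
  tgt : E → V
  arc : E → unitInterval → ℂ
  pos_injective : Function.Injective pos
  arc_continuous : ∀ e, Continuous (arc e)
  arc_injective : ∀ e, Function.Injective (arc e)
  arc_zero : ∀ e, arc e 0 = pos (src e)
  arc_one : ∀ e, arc e 1 = pos (tgt e)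
  arc_ne_pos : ∀ e x v, arc e x = pos v → x = 0 ∨ x = 1
  arc_disjoint : ∀ e e' x x', e ≠ e' → arc e x = arc e' x' → x = 0 ∨ x = 1

namespace PlaneGraph

variable {V E : Type*} (G : PlaneGraph V E)

/-- The edge `e` has ends `u` and `v`. -/
def Joins (e : E) (u v : V) : Prop :=
  (G.src e = u ∧ G.tgt e = v) ∨ (G.src e = v ∧ G.tgt e = u)

/-- The underlying simple graph (parallel edges merged). -/
def toSimpleGraph : SimpleGraph V where
  Adj u v := u ≠ v ∧ ∃ e, G.Joins e u v
  symm := ⟨fun _ _ h => ⟨h.1.symm, h.2.imp fun _ he => Or.symm he⟩⟩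
  loopless := ⟨fun _ h => h.1 rfl⟩

/-- The degree of a vertex: the number of incident edges, counted with multiplicity. -/
noncomputable def degree (v : V) : ℕ∞ :=
  {e | G.src e = v ∨ G.tgt e = v}.encard

/-- The set of points of the plane that are used by the drawing. -/
def drawing : Set ℂ :=
  Set.range G.pos ∪ ⋃ e, Set.range (G.arc e)

/-- The faces: the connected components of the complement of the drawing. -/
def Face : Type :=
  {f : Set ℂ // ∃ z ∈ G.drawingᶜ, f = connectedComponentIn G.drawingᶜ z}

variable {G} in
/-- The outer face is the unbounded one. -/
def Face.IsOuter (f : G.Face) : Prop :=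
  ¬ Bornology.IsBounded f.1

/-- The vertex `v` lies on the boundary of the face `f`. -/
def Incident (v : V) (f : G.Face) : Prop :=
  G.pos v ∈ frontier f.1

/-- The vertex `v` belongs to the outer face. -/
def OnOuterFace (v : V) : Prop :=
  ∃ f : G.Face, f.IsOuter ∧ G.Incident v f

/-- The radial completion: one new vertex for every face, adjacent to all vertices incident to that
face, together with the edges of `G` (one copy of each edge is kept, so the graph is simple). -/
def radialCompletion : SimpleGraph (V ⊕ G.Face) where
  Adj
    | Sum.inl u, Sum.inl v => G.toSimpleGraph.Adj u v
    | Sum.inl u, Sum.inr f => G.Incident u f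
    | Sum.inr f, Sum.inl u => G.Incident u f
    | Sum.inr _, Sum.inr _ => False
  symm := ⟨by
    rintro (u | f) (v | f') h
    · exact SimpleGraph.Adj.symm h
    · exact h
    · exact h
    · exact h⟩
  loopless := ⟨by
    rintro (u | f) h
    · exact G.toSimpleGraph.irrefl h
    · exact h⟩

/-- The edges of the radial graph: the incident pairs of a vertex and a face. -/
def RadialEdge : Type _ :=
  {p : V × G.Face // G.Incident p.1 p.2}

/-- `H` is a plane embedding of the radial completion of `G`: its drawing coincides with that of `G`
on the vertices and edges of `G`, the vertex of every face is drawn inside that face, and every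
further edge joins a vertex of `G` to the vertex of a face incident to it. -/
structure IsRadialEmbedding (H : PlaneGraph (V ⊕ G.Face) (E ⊕ G.RadialEdge)) : Prop where
  pos_vertex : ∀ v, H.pos (Sum.inl v) = G.pos v
  src_edge : ∀ e, H.src (Sum.inl e) = Sum.inl (G.src e)
  tgt_edge : ∀ e, H.tgt (Sum.inl e) = Sum.inl (G.tgt e)
  arc_edge : ∀ e, H.arc (Sum.inl e) = G.arc e
  pos_face : ∀ f : G.Face, H.pos (Sum.inr f) ∈ f.1
  src_radial : ∀ p : G.RadialEdge, H.src (Sum.inr p) = Sum.inl p.1.1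
  tgt_radial : ∀ p : G.RadialEdge, H.tgt (Sum.inr p) = Sum.inr p.1.2

/-- A cycle: cyclically ordered distinct vertices, consecutive ones being joined by distinct edges.
Two parallel edges form a cycle of length two. -/
structure Cycle where
  len : ℕ
  two_le_len : 2 ≤ len
  vert : ZMod len → V
  edge : ZMod len → E
  vert_injective : Function.Injective vert
  edge_injective : Function.Injective edge
  joins : ∀ i, G.Joins (edge i) (vert i) (vert (i + 1))

namespace Cycle

variable {G}

/-- The closed curve that is the drawing of the cycle. -/
def carrier (C : G.Cycle) : Set ℂ :=
  ⋃ i, Set.range (G.arc (C.edge i))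

/-- The strict interior of a cycle: the points off the cycle that lie in a bounded region of the
complement of its drawing. -/
def strictInterior (C : G.Cycle) : Set ℂ :=
  {z | z ∉ C.carrier ∧ Bornology.IsBounded (connectedComponentIn C.carrierᶜ z)}

end Cycle

variable {G}

/-- A sequence of cycles is concentric if each one is drawn in the strict interior of the next. -/
def Concentric {t : ℕ} (C : Fin t → G.Cycle) : Prop :=
  ∀ i j : Fin t, (i : ℕ) + 1 = j → (C i).carrier ⊆ (C j).strictInterior

/-- A sequence of cycles is `U`-free if no vertex of `U` is drawn in the strict interior of its last
cycle. -/
def IsFree (U : Set V) {t : ℕ} (C : Fin t → G.Cycle) : Prop :=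
  ∀ i : Fin t, (i : ℕ) + 1 = t → ∀ u ∈ U, G.pos u ∉ (C i).strictInterior

end PlaneGraph

/-- A tree decomposition of a graph. -/
structure TreeDecomposition {V : Type*} (G : SimpleGraph V) where
  Node : Type
  finite_node : Finite Node
  tree : SimpleGraph Node
  isTree : tree.IsTree
  bag : Node → Finset V
  adj_mem : ∀ x y, G.Adj x y → ∃ i, x ∈ bag i ∧ y ∈ bag i
  isTree_induce : ∀ x, (tree.induce {i | x ∈ bag i}).IsTree

/-- The treewidth of a (finite) graph: the least `w` for which some tree decomposition has all its
bags of size at most `w + 1`. -/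
noncomputable def treewidth {V : Type*} (G : SimpleGraph V) : ℕ :=
  sInf {w | ∃ D : TreeDecomposition G, ∀ i, (D.bag i).card ≤ w + 1}

/-- An instance `(G, S, T, g, k)` of Planar Disjoint Paths. -/
structure PDPInstance (V E : Type*) where
  graph : PlaneGraph V E
  S : Finset V
  T : Finset V
  g : S → T
  k : ℕ
  card_S : S.card = k
  g_bijective : Function.Bijective g

namespace PDPInstance

variable {V E : Type*} (I : PDPInstance V E)

/-- The set `S ∪ T` of terminals. -/
def terminals : Set V := {v | v ∈ I.S ∨ v ∈ I.T}

/-- An instance is nice if all terminals have degree one and no vertex is in both `S` and `T`. -/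
def IsNice : Prop :=
  (∀ v ∈ I.terminals, I.graph.degree v = 1) ∧ Disjoint I.S I.T

/-- An instance is good, with respect to the constant `c`, if it is nice, some terminal of `T`
belongs to the outer faces of both the graph and its (embedded) radial completion, the treewidth is
at most `2 ^ (c k)`, and no `S ∪ T`-free sequence of concentric cycles is longer than
`2 ^ (c k)`. -/
structure IsGood (c : ℝ) : Prop where
  nice : I.IsNice
  outer : ∃ t ∈ I.T, I.graph.OnOuterFace t ∧
    ∃ H : PlaneGraph (V ⊕ I.graph.Face) (E ⊕ I.graph.RadialEdge),
      I.graph.IsRadialEmbedding H ∧ H.OnOuterFace (Sum.inl t)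
  treewidth_le : (treewidth I.graph.toSimpleGraph : ℝ) ≤ 2 ^ (c * I.k)
  concentric_le : ∀ (t : ℕ) (C : Fin t → I.graph.Cycle),
    PlaneGraph.Concentric C → PlaneGraph.IsFree I.terminals C → (t : ℝ) ≤ 2 ^ (c * I.k)

/-- A Steiner tree: a subtree of the radial completion whose set of leaves (vertices of degree one)
is exactly the set of terminals. -/
def IsSteinerTree (R : I.graph.radialCompletion.Subgraph) : Prop :=
  R.coe.IsTree ∧ {x | (R.neighborSet x).encard = 1} = Sum.inl '' I.terminals

end PDPInstance

/-- The bound `4 · 2 ^ (c k)`. -/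
noncomputable def alphaDist (c : ℝ) (k : ℕ) : ℝ := 4 * 2 ^ (c * k)

/-! Suppose that every vertex of the Steiner tree `R` is at distance more than `4B` from `v` in the
radial completion, where `B = 2 ^ (c k)`, and let `N = ⌊B⌋`. For `i ≤ N`, let layer `i` consist of
the vertices of `G` at distance `2i+1` or `2i+2` from `v`. Faces are not adjacent to each other, so
a walk cannot cross two consecutive distance levels without using a vertex of `G`. Hence each of
these layers separates `v` from the terminal `t` on the outer face (`not_radialConn_layer`).

Separation in the radial completion is separation in the plane: walks avoiding `X` stay in one
component of the complement of the drawing of `G[X]`, and conversely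
(`RadialConn.mem_connectedComponentIn`, `radialConn_of_mem_connectedComponentIn`). A plane drawing
that separates two points contains a cycle that separates them (`exists_cycle_separating`). So layer
`i` contains a cycle `C i` with `v` and `t` on different sides. The side of `t` is unbounded, so
that of `v` is bounded. The earlier cycle is joined to `v` by walks avoiding the next layer, which
makes the cycles concentric (`exists_concentric`). The tree is connected and lies beyond the last
layer, so all terminals are on the unbounded side of the last cycle, together with `t`. These `N + 1
> B` cycles contradict goodness.

The plane topology needs no Jordan curve theorem. It rests on a criterion of Eilenberg: two points
`p`, `q` off a compact set `K` lie in the same component of `Kᶜ` if and only if `(z - q) / (z - p)`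
has a continuous logarithm on `K` (`hasLog_of_mem_connectedComponentIn`,
`mem_connectedComponentIn_of_hasLog`). Logarithms can be glued along preconnected intersections,
which allows arguments edge by edge. -/

open Set Topology

/-! ### Continuous logarithms and components of plane complements -/

/-- The function `f` has a continuous logarithm on the set `K`. -/
def HasLog (K : Set ℂ) (f : ℂ → ℂ) : Prop :=
  ∃ h : ℂ → ℂ, ContinuousOn h K ∧ ∀ z ∈ K, Complex.exp (h z) = f z

/-- The difference of two logarithms of one function is continuous with values in the countable set
`2πiℤ`, so it cannot vary on a preconnected set. -/
theorem IsPreconnected.eq_of_exp_eq {α : Type*} [TopologicalSpace α] {S : Set α}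
    (hS : IsPreconnected S) {h₁ h₂ : α → ℂ} (c₁ : ContinuousOn h₁ S) (c₂ : ContinuousOn h₂ S)
    (h : ∀ x ∈ S, Complex.exp (h₁ x) = Complex.exp (h₂ x)) {x y : α} (hx : x ∈ S) (hy : y ∈ S) :
    h₁ x - h₂ x = h₁ y - h₂ y := by
  have hc : ({z : ℂ | Complex.exp z = 1}).Countable := by
    refine (countable_range fun n : ℤ => (n : ℂ) * (2 * Real.pi * Complex.I)).mono ?_
    intro z hz
    obtain ⟨n, hn⟩ := Complex.exp_eq_one_iff.1 hz
    exact ⟨n, hn.symm⟩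
  refine hc.isTotallyDisconnected ((fun x => h₁ x - h₂ x) '' S) ?_ (hS.image _ (c₁.sub c₂))
    (mem_image_of_mem _ hx) (mem_image_of_mem _ hy)
  rintro _ ⟨z, hz, rfl⟩
  simp [Complex.exp_sub, h z hz, Complex.exp_ne_zero]

namespace HasLog

variable {K A B : Set ℂ} {f g : ℂ → ℂ}

theorem mono (h : HasLog B f) (hAB : A ⊆ B) : HasLog A f := by
  obtain ⟨l, hl, hf⟩ := h
  exact ⟨l, hl.mono hAB, fun z hz => hf z (hAB hz)⟩

theorem congr (h : HasLog K f) (hfg : ∀ z ∈ K, f z = g z) : HasLog K g := by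
  obtain ⟨l, hl, hf⟩ := h
  exact ⟨l, hl, fun z hz => (hf z hz).trans (hfg z hz)⟩

theorem mul (hf : HasLog K f) (hg : HasLog K g) : HasLog K (fun z => f z * g z) := by
  obtain ⟨l, hl, hl'⟩ := hf
  obtain ⟨m, hm, hm'⟩ := hg
  exact ⟨fun z => l z + m z, hl.add hm, fun z hz => by rw [Complex.exp_add, hl' z hz, hm' z hz]⟩

theorem inv (hf : HasLog K f) : HasLog K (fun z => (f z)⁻¹) := by
  obtain ⟨l, hl, hl'⟩ := hf
  exact ⟨fun z => - l z, hl.neg, fun z hz => by rw [Complex.exp_neg, hl' z hz]⟩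

/-- Logarithms on two closed sets can be glued once they agree on the intersection. -/
theorem union_of_eqOn (hA : IsClosed A) (hB : IsClosed B) {l m : ℂ → ℂ}
    (hl : ContinuousOn l A) (hl' : ∀ z ∈ A, Complex.exp (l z) = f z)
    (hm : ContinuousOn m B) (hm' : ∀ z ∈ B, Complex.exp (m z) = f z)
    (h : ∀ z ∈ A ∩ B, l z = m z) : HasLog (A ∪ B) f := by
  classical
  have e₁ : EqOn (A.piecewise l m) l A := fun z hz => piecewise_eq_of_mem _ _ _ hz
  have e₂ : EqOn (A.piecewise l m) m B := fun z hz => by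
    by_cases hzA : z ∈ A
    · rw [piecewise_eq_of_mem _ _ _ hzA, h z ⟨hzA, hz⟩]
    · exact piecewise_eq_of_notMem _ _ _ hzA
  refine ⟨A.piecewise l m, (hl.congr e₁).union_of_isClosed (hm.congr e₂) hA hB, ?_⟩
  rintro z (hz | hz)
  · rw [e₁ hz, hl' z hz]
  · rw [e₂ hz, hm' z hz]

/-- On a preconnected overlap the two logarithms differ by a constant; shifting one of them by it
makes them agree. -/
theorem union (hA : IsClosed A) (hB : IsClosed B) (hAB : IsPreconnected (A ∩ B))
    (hfA : HasLog A f) (hfB : HasLog B f) : HasLog (A ∪ B) f := by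
  obtain ⟨l, hl, hl'⟩ := hfA
  obtain ⟨m, hm, hm'⟩ := hfB
  rcases (A ∩ B).eq_empty_or_nonempty with he | ⟨x, hx⟩
  · exact union_of_eqOn hA hB hl hl' hm hm' (by simp [he])
  · refine union_of_eqOn (m := fun z => m z + (l x - m x)) hA hB hl hl'
      (hm.add continuousOn_const) (fun z hz => ?_) (fun z hz => ?_)
    · rw [Complex.exp_add, Complex.exp_sub, hl' x hx.1, hm' x hx.2, ← hm' x hx.2,
        div_self (Complex.exp_ne_zero _), mul_one, hm' z hz]
    · have := hAB.eq_of_exp_eq (hl.mono inter_subset_left) (hm.mono inter_subset_right)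
        (fun z hz => by rw [hl' z hz.1, hm' z hz.2]) hz hx
      rw [← this]; ring

end HasLog

/-- A subarc of a simple arc carries a logarithm of every nowhere vanishing continuous function. -/
theorem HasLog.of_arc {γ : unitInterval → ℂ} (hγ : Continuous γ) (hi : Function.Injective γ)
    {a b : unitInterval} (hab : a ≤ b) {f : ℂ → ℂ} (hf : ContinuousOn f (γ '' Icc a b))
    (h0 : ∀ z ∈ γ '' Icc a b, f z ≠ 0) :
    HasLog (γ '' Icc a b) f := by
  -- Clamping the parameter to `[a, b]` extends `f ∘ γ` to the whole real line, over which it lifts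
  -- through the covering `exp`.
  have hmem : ∀ x : ℝ, γ (max a (min b (projIcc 0 1 zero_le_one x))) ∈ γ '' Icc a b := fun x =>
    mem_image_of_mem _ ⟨le_max_left _ _, max_le hab (min_le_left _ _)⟩
  have hcont : Continuous fun x : ℝ => f (γ (max a (min b (projIcc 0 1 zero_le_one x)))) :=
    hf.comp_continuous
      (hγ.comp (continuous_const.max (continuous_const.min continuous_projIcc))) hmem
  obtain ⟨F, ⟨-, hF⟩, -⟩ := Complex.isCoveringMapOn_exp.existsUnique_continuousMap_lifts
    ⟨_, hcont⟩ (a₀ := 0) (Complex.exp_log (h0 _ (hmem _))) (fun x => h0 _ (hmem _))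
  have hemb := (hγ.isClosedEmbedding hi).isEmbedding
  have hleft : ∀ x, Function.invFun γ (γ x) = x := Function.leftInverse_invFun hi
  refine ⟨fun z => F (Function.invFun γ z : unitInterval), ?_, ?_⟩
  · have : ContinuousOn (Function.invFun γ) (range γ) := by
      rw [continuousOn_iff_continuous_domRestrict]
      have h2 := hemb.toHomeomorph.symm.continuous
      convert h2 using 1
      ext ⟨_, x, rfl⟩
      rw [Set.domRestrict_apply, hleft]
      exact congrArg _ ((hemb.toHomeomorph.symm_apply_apply x).symm)
    exact F.continuous.comp_continuousOn
      (continuous_subtype_val.comp_continuousOn (this.mono (image_subset_range _ _)))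
  · rintro _ ⟨x, hx, rfl⟩
    simp only [hleft]
    exact (congrFun hF x).trans (by simp [hx.1, hx.2])

/-- The quotient is `1 + (x - y) / (z - x)` with a second term of norm less than `1`, so the
principal logarithm is continuous there. This is the local step of the easy half of the criterion.
-/
theorem hasLog_div_of_mem_ball {K : Set ℂ} {x y : ℂ} {r : ℝ} (hK : Disjoint (Metric.ball x r) K)
    (hy : y ∈ Metric.ball x r) : HasLog K (fun z => (z - y) / (z - x)) := by
  have hxK : ∀ z ∈ K, r ≤ ‖z - x‖ := fun z hz => by
    by_contra! h
    exact disjoint_left.1 hK (by simpa [dist_eq_norm] using h) hz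
  have hr : ‖x - y‖ < r := by rw [norm_sub_rev]; simpa [dist_eq_norm] using hy
  have hne : ∀ z ∈ K, z - x ≠ 0 := fun z hz => by
    have := hxK z hz
    rw [← norm_pos_iff]; linarith [norm_nonneg (x - y)]
  have hform : ∀ z ∈ K, (z - y) / (z - x) = 1 + (x - y) / (z - x) := fun z hz => by
    have := hne z hz
    field_simp; ring
  have hsl : ∀ z ∈ K, (z - y) / (z - x) ∈ Complex.slitPlane := fun z hz => by
    rw [hform z hz]
    apply Complex.mem_slitPlane_of_norm_lt_one
    have := hxK z hz
    rw [norm_div, div_lt_one (norm_pos_iff.2 (hne z hz))]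
    linarith
  refine ⟨fun z => Complex.log ((z - y) / (z - x)), ?_, fun z hz => ?_⟩
  · refine ContinuousOn.clog (ContinuousOn.div (by fun_prop) (by fun_prop) hne) hsl
  · exact Complex.exp_log (Complex.slitPlane_ne_zero (hsl z hz))

theorem hasLog_symm {K : Set ℂ} {x y : ℂ} (h : HasLog K (fun z => (z - y) / (z - x))) :
    HasLog K (fun z => (z - x) / (z - y)) :=
  h.inv.congr fun z _ => by rw [inv_div]

theorem hasLog_trans {K : Set ℂ} {x y w : ℂ} (hy : y ∉ K)
    (h : HasLog K (fun z => (z - y) / (z - x))) (h' : HasLog K (fun z => (z - w) / (z - y))) :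
    HasLog K (fun z => (z - w) / (z - x)) :=
  (h'.mul h).congr fun z hz => by
    have : z - y ≠ 0 := sub_ne_zero.2 fun e => hy (e ▸ hz)
    field_simp

/-- Two points in the same component of the complement of a closed set `K` have a continuous
logarithm of the quotient of the distances on `K`. -/
theorem hasLog_of_mem_connectedComponentIn {K : Set ℂ} (hK : IsClosed K) {p q : ℂ}
    (hp : p ∉ K) (h : q ∈ connectedComponentIn Kᶜ p) :
    HasLog K (fun z => (z - q) / (z - p)) := by
  have hsub := connectedComponentIn_subset Kᶜ p
  refine IsPreconnected.induction₂' (s := connectedComponentIn Kᶜ p)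
    isPreconnected_connectedComponentIn
    (fun x y => HasLog K (fun z => (z - y) / (z - x)))
    (fun x hx => ?_) (fun x y w hx hy hw h1 h2 => ?_)
    (mem_connectedComponentIn hp) h
  · obtain ⟨r, hr, hball⟩ := Metric.isOpen_iff.1 hK.isOpen_compl x (hsub hx)
    filter_upwards [mem_nhdsWithin_of_mem_nhds (Metric.ball_mem_nhds x hr)] with y hy
    have := hasLog_div_of_mem_ball (subset_compl_iff_disjoint_right.1 hball) hy
    exact ⟨this, hasLog_symm this⟩
  · exact hasLog_trans (hsub hy) h1 h2

theorem frontier_connectedComponentIn_subset {K : Set ℂ} (hK : IsClosed K) (p : ℂ) :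
    frontier (connectedComponentIn Kᶜ p) ⊆ K := by
  intro x hx
  by_contra hxK
  have ho : IsOpen (connectedComponentIn Kᶜ p) := hK.isOpen_compl.connectedComponentIn
  have hox : IsOpen (connectedComponentIn Kᶜ x) := hK.isOpen_compl.connectedComponentIn
  rw [ho.frontier_eq] at hx
  obtain ⟨y, hy1, hy2⟩ := mem_closure_iff.1 hx.1 _ hox (mem_connectedComponentIn hxK)
  have := (connectedComponentIn_eq hy1).trans (connectedComponentIn_eq hy2).symm
  exact hx.2 (this ▸ mem_connectedComponentIn hxK)

/-- For `r ≥ 0` the set is the image under `exp` of a convex set. -/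
theorem isPreconnected_norm_gt (r : ℝ) : IsPreconnected {z : ℂ | r < ‖z‖} := by
  rcases lt_or_ge r 0 with hr | hr
  · have : {z : ℂ | r < ‖z‖} = univ := by
      ext z; simpa using hr.trans_le (norm_nonneg z)
    rw [this]; exact isPreconnected_univ
  have hs : IsPreconnected {w : ℂ | r < Real.exp w.re} := by
    apply Convex.isPreconnected
    intro x hx y hy a b ha hb hab
    simp only [mem_ofPred_eq] at *
    have : min x.re y.re ≤ (a • x + b • y).re := by
      simp only [Complex.add_re, Complex.real_smul, Complex.mul_re, Complex.ofReal_re,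
        Complex.ofReal_im, zero_mul, sub_zero]
      calc min x.re y.re = a * min x.re y.re + b * min x.re y.re := by rw [← add_mul, hab, one_mul]
        _ ≤ a * x.re + b * y.re := by gcongr; exacts [min_le_left _ _, min_le_right _ _]
    refine lt_of_lt_of_le ?_ (Real.exp_le_exp.2 this)
    rcases min_choice x.re y.re with h | h <;> rw [h] <;> assumption
  convert hs.image Complex.exp Complex.continuous_exp.continuousOn using 1
  ext z
  constructor
  · intro hz
    have hz0 : z ≠ 0 := norm_pos_iff.1 (hr.trans_lt hz)
    refine ⟨Complex.log z, ?_, Complex.exp_log hz0⟩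
    rw [mem_ofPred_eq, ← Complex.norm_exp, Complex.exp_log hz0]
    exact hz
  · rintro ⟨w, hw, rfl⟩
    rw [mem_ofPred_eq, Complex.norm_exp]
    exact hw

/-- The complement of a bounded set has at most one unbounded component. -/
theorem connectedComponentIn_eq_of_not_isBounded {K : Set ℂ} (hK : Bornology.IsBounded K) {p q : ℂ}
    (hp : ¬ Bornology.IsBounded (connectedComponentIn Kᶜ p))
    (hq : ¬ Bornology.IsBounded (connectedComponentIn Kᶜ q)) :
    connectedComponentIn Kᶜ p = connectedComponentIn Kᶜ q := by
  obtain ⟨r, hr⟩ := hK.subset_closedBall 0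
  have hsub : {z : ℂ | r < ‖z‖} ⊆ Kᶜ := fun z hz hzK => by
    have := hr hzK
    simp only [Metric.mem_closedBall, dist_zero_right] at this
    exact absurd this (not_le.2 hz)
  have key : ∀ D : Set ℂ, ¬ Bornology.IsBounded D → ∃ z ∈ D, r < ‖z‖ := fun D hD => by
    by_contra! h
    exact hD ((Metric.isBounded_closedBall (x := (0 : ℂ)) (r := r)).subset
      fun z hz => by simpa using h z hz)
  obtain ⟨a, ha, har⟩ := key _ hp
  obtain ⟨b, hb, hbr⟩ := key _ hq
  rw [connectedComponentIn_eq ha, connectedComponentIn_eq hb]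
  exact connectedComponentIn_eq
    ((isPreconnected_norm_gt r).subset_connectedComponentIn har hsub hbr)

/-- A nowhere vanishing continuous function on the plane does not agree with `z - p` outside of a
disc around `p`. -/
theorem false_of_ne_zero_of_eq_sub {F : ℂ → ℂ} (hF : Continuous F) (h0 : ∀ z, F z ≠ 0) {p : ℂ}
    {r : ℝ} (hr : 0 < r) (hFr : ∀ z, r ≤ ‖z - p‖ → F z = z - p) : False := by
  obtain ⟨l, ⟨-, hl'⟩, -⟩ := Complex.isCoveringMapOn_exp.existsUnique_continuousMap_lifts
    ⟨F, hF⟩ (a₀ := 0) (Complex.exp_log (h0 0)) h0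
  -- On the circle of radius `r` around `p`, the global logarithm would differ from `log r + iθ` by
  -- a constant; but it is `2π`-periodic in `θ`.
  have hconst := (isPreconnected_univ (α := ℝ)).eq_of_exp_eq
    (h₁ := fun θ : ℝ => l (p + r * Complex.exp (θ * Complex.I)))
    (h₂ := fun θ : ℝ => Complex.log r + θ * Complex.I)
    (by fun_prop) (by fun_prop) (fun θ _ => by
      have : Complex.exp (l (p + r * Complex.exp (θ * Complex.I))) = _ := congrFun hl' _
      rw [this, ContinuousMap.coe_mk, hFr _ (by simp [abs_of_pos hr, Complex.norm_exp]), Complex.exp_add, Complex.exp_log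
        (by exact_mod_cast hr.ne')]
      ring) (mem_univ 0) (mem_univ (2 * Real.pi))
  simp [Complex.exp_two_pi_mul_I, Real.pi_ne_zero] at hconst

/-- Two points off a compact set `K` that are in distinct components of its complement have no
continuous logarithm of the quotient of the distances on `K`. -/
theorem mem_connectedComponentIn_of_hasLog {K : Set ℂ} (hK : IsCompact K) {p q : ℂ}
    (hp : p ∉ K) (hq : q ∉ K) (h : HasLog K (fun z => (z - q) / (z - p))) :
    q ∈ connectedComponentIn Kᶜ p := by
  by_contra hne
  have hne' : p ∉ connectedComponentIn Kᶜ q := fun h' =>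
    hne ((connectedComponentIn_eq h').symm ▸ mem_connectedComponentIn hq)
  wlog hb : Bornology.IsBounded (connectedComponentIn Kᶜ p) generalizing p q
  · refine this hq hp (hasLog_symm h) hne' hne ?_
    by_contra hb'
    rw [connectedComponentIn_eq_of_not_isBounded hK.isBounded hb hb'] at hne
    exact hne (mem_connectedComponentIn hq)
  obtain ⟨l, hl, hl'⟩ := hasLog_symm h
  -- Tietze extension of the logarithm `l` of `(z - p) / (z - q)` from `K` to the plane. Replacing
  -- `z - p` by `(z - q) * exp (L z)` inside the bounded component of `p` removes its only zero; the
  -- two formulas agree on the frontier, which is contained in `K`.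
  obtain ⟨L, hL⟩ := ContinuousMap.exists_restrict_eq hK.isClosed
    ⟨K.domRestrict l, continuousOn_iff_continuous_domRestrict.1 hl⟩
  have hLl : ∀ z ∈ K, L z = l z := fun z hz => congrArg (fun f => f ⟨z, hz⟩) hL
  classical
  obtain ⟨r, hr⟩ := hb.subset_ball p
  have hr0 : 0 < r := by
    have := hr (mem_connectedComponentIn hp)
    simpa using this
  refine false_of_ne_zero_of_eq_sub (p := p) (r := r)
    (F := fun z => if z ∈ connectedComponentIn Kᶜ p then (z - q) * Complex.exp (L z) else z - p)
    ?_ ?_ hr0 ?_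
  · refine Continuous.if (fun z hz => ?_) (by fun_prop) (by fun_prop)
    have hzK := frontier_connectedComponentIn_subset hK.isClosed p hz
    rw [hLl z hzK, hl' z hzK]
    have : z - q ≠ 0 := sub_ne_zero.2 fun e => hq (e ▸ hzK)
    field_simp
  · intro z
    split_ifs with hz
    · exact mul_ne_zero (sub_ne_zero.2 fun e => hne (e ▸ hz)) (Complex.exp_ne_zero _)
    · refine sub_ne_zero.2 fun e => hz ?_
      rw [e]
      exact mem_connectedComponentIn hp
  · intro z hz
    refine if_neg fun hz' => ?_
    have := hr hz'
    rw [Metric.mem_ball, dist_eq_norm] at this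
    linarith

/-! ### Faces and the edges on their boundaries -/

namespace PlaneGraph

variable {V E : Type*} {G : PlaneGraph V E}

theorem pos_mem_drawing (v : V) : G.pos v ∈ G.drawing := Or.inl (mem_range_self v)

theorem arc_mem_drawing (e : E) (s : unitInterval) : G.arc e s ∈ G.drawing :=
  Or.inr (mem_iUnion.2 ⟨e, mem_range_self s⟩)

theorem isCompact_range_arc (e : E) : IsCompact (range (G.arc e)) :=
  isCompact_range (G.arc_continuous e)

theorem isCompact_drawing [Finite V] [Finite E] : IsCompact G.drawing :=
  (finite_range G.pos).isCompact.union (isCompact_iUnion isCompact_range_arc)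

namespace Face

theorem eq_connectedComponentIn (f : G.Face) {z : ℂ} (hz : z ∈ f.1) :
    f.1 = connectedComponentIn G.drawingᶜ z := by
  obtain ⟨w, -, h⟩ := f.2
  rw [h] at hz ⊢
  exact connectedComponentIn_eq hz

theorem nonempty (f : G.Face) : f.1.Nonempty := by
  obtain ⟨w, hw, h⟩ := f.2
  exact ⟨w, h ▸ mem_connectedComponentIn hw⟩

theorem isPreconnected (f : G.Face) : IsPreconnected f.1 := by
  obtain ⟨w, -, h⟩ := f.2
  rw [h]; exact isPreconnected_connectedComponentIn

theorem notMem_drawing (f : G.Face) {z : ℂ} (hz : z ∈ f.1) : z ∉ G.drawing := by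
  obtain ⟨w, -, h⟩ := f.2
  rw [h] at hz
  exact connectedComponentIn_subset _ _ hz

theorem isOpen [Finite V] [Finite E] (f : G.Face) : IsOpen f.1 := by
  obtain ⟨w, -, h⟩ := f.2
  rw [h]; exact isCompact_drawing.isClosed.isOpen_compl.connectedComponentIn

theorem frontier_subset [Finite V] [Finite E] (f : G.Face) : frontier f.1 ⊆ G.drawing := by
  obtain ⟨w, -, h⟩ := f.2
  rw [h]; exact frontier_connectedComponentIn_subset isCompact_drawing.isClosed w

theorem eq_of_mem {f f' : G.Face} {z : ℂ} (hz : z ∈ f.1) (hz' : z ∈ f'.1) : f = f' :=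
  Subtype.ext ((f.eq_connectedComponentIn hz).trans (f'.eq_connectedComponentIn hz').symm)

end Face

theorem exists_face {z : ℂ} (hz : z ∉ G.drawing) : ∃ f : G.Face, z ∈ f.1 :=
  ⟨⟨connectedComponentIn G.drawingᶜ z, z, hz, rfl⟩, mem_connectedComponentIn hz⟩

/-- The drawing with the part of the curve of `e` removed that has its parameters in `J`. -/
def cutDrawing (G : PlaneGraph V E) (e : E) (J : Set unitInterval) : Set ℂ :=
  range G.pos ∪ (⋃ e' ∈ {e' | e' ≠ e}, range (G.arc e')) ∪ G.arc e '' Jᶜ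

theorem cutDrawing_subset (e : E) (J : Set unitInterval) : G.cutDrawing e J ⊆ G.drawing := by
  rintro z ((hz | hz) | ⟨s, -, rfl⟩)
  · exact Or.inl hz
  · simp only [mem_iUnion] at hz
    obtain ⟨e', -, h⟩ := hz
    exact Or.inr (mem_iUnion.2 ⟨e', h⟩)
  · exact arc_mem_drawing e s

theorem isCompact_cutDrawing [Finite V] [Finite E] (e : E) {J : Set unitInterval}
    (hJ : IsOpen J) : IsCompact (G.cutDrawing e J) :=
  ((finite_range G.pos).isCompact.union
    ((toFinite _).isCompact_biUnion fun e' _ => isCompact_range_arc e')).union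
    (hJ.isClosed_compl.isCompact.image (G.arc_continuous e))

theorem drawing_subset_cutDrawing_union (e : E) (J : Set unitInterval) :
    G.drawing ⊆ G.cutDrawing e J ∪ G.arc e '' J := by
  classical
  rintro z (hz | hz)
  · exact Or.inl (Or.inl (Or.inl hz))
  · obtain ⟨e', s, rfl⟩ := mem_iUnion.1 hz
    by_cases he : e' = e
    · subst he
      by_cases hs : s ∈ J
      · exact Or.inr (mem_image_of_mem _ hs)
      · exact Or.inl (Or.inr (mem_image_of_mem _ hs))
    · exact Or.inl (Or.inl (Or.inr (mem_biUnion (x := e') he (mem_range_self s))))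

theorem arc_mem_cutDrawing_iff {e : E} {J : Set unitInterval} {s : unitInterval} (h0 : s ≠ 0)
    (h1 : s ≠ 1) : G.arc e s ∈ G.cutDrawing e J ↔ s ∉ J := by
  constructor
  · rintro ((⟨v, hv⟩ | hz) | ⟨t, ht, hts⟩) hs
    · exact (G.arc_ne_pos e s v hv.symm).elim h0 h1
    · simp only [mem_iUnion] at hz
      obtain ⟨e', he', t, ht⟩ := hz
      exact (G.arc_disjoint e e' s t he'.symm ht.symm).elim h0 h1
    · exact ht (G.arc_injective e hts ▸ hs)
  · exact fun hs => Or.inr (mem_image_of_mem _ hs)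

/-- A face with an interior point of the curve of `e` on its boundary has every interior point of
this curve on its boundary. -/
theorem arc_mem_frontier_of_arc_mem_frontier [Finite V] [Finite E] (f : G.Face) {e : E}
    {s t : unitInterval} (hs0 : 0 < s) (hs1 : s < 1) (ht0 : 0 < t) (ht1 : t < 1)
    (hs : G.arc e s ∈ frontier f.1) : G.arc e t ∈ frontier f.1 := by
  by_contra ht
  -- If `arc e t` is off the frontier, so is a short piece `J` of the curve around it. Opening the
  -- larger piece `J'`, which contains `s` and `t`, connects the face to `arc e t`. Closing the
  -- curve again up to `J` does not disconnect them, so the face would reach `arc e t` through the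
  -- gap `J`, although it has no frontier points there.
  obtain ⟨a', ha0, ha'⟩ := exists_between (lt_min hs0 ht0)
  obtain ⟨b', hb', hb1⟩ := exists_between (max_lt hs1 ht1)
  have ha's : a' < s := ha'.trans_le (min_le_left _ _)
  have ha't : a' < t := ha'.trans_le (min_le_right _ _)
  have hb's : s < b' := (le_max_left _ _).trans_lt hb'
  have hb't : t < b' := (le_max_right _ _).trans_lt hb'
  have hU : (G.arc e ⁻¹' (frontier f.1)ᶜ) ∩ Ioo a' b' ∈ 𝓝 t :=
    Filter.inter_mem ((isClosed_frontier.isOpen_compl.preimage (G.arc_continuous e)).mem_nhds ht)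
      (Ioo_mem_nhds ha't hb't)
  obtain ⟨a, b, htab, hab⟩ := (mem_nhds_iff_exists_Ioo_subset' ⟨a', ha't⟩ ⟨b', hb't⟩).1 hU
  wlog haa : a' ≤ a ∧ b ≤ b' generalizing a b
  · refine this (max a a') (min b b') ⟨max_lt htab.1 ha't, lt_min htab.2 hb't⟩
      ((Ioo_subset_Ioo (le_max_left _ _) (min_le_left _ _)).trans hab)
      ⟨le_max_right _ _, min_le_right _ _⟩
  obtain ⟨haa, hbb⟩ := haa
  set J := Ioo a b
  set J' := Ioo a' b'
  have hK := isCompact_cutDrawing (G := G) e (isOpen_Ioo (a := a) (b := b))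
  have hK' := isCompact_cutDrawing (G := G) e (isOpen_Ioo (a := a') (b := b'))
  have hxK' : G.arc e s ∉ G.cutDrawing e J' := by
    rw [arc_mem_cutDrawing_iff hs0.ne' hs1.ne, not_not]; exact ⟨ha's, hb's⟩
  have hyK' : G.arc e t ∉ G.cutDrawing e J' := by
    rw [arc_mem_cutDrawing_iff ht0.ne' ht1.ne, not_not]; exact ⟨ha't, hb't⟩
  have hyK : G.arc e t ∉ G.cutDrawing e J := by
    rw [arc_mem_cutDrawing_iff ht0.ne' ht1.ne, not_not]; exact htab
  -- a point of the face in the same component of the complement of the larger cut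
  obtain ⟨p, hpx, hpf⟩ := mem_closure_iff.1 (frontier_subset_closure hs) _
    (hK'.isClosed.isOpen_compl.connectedComponentIn) (mem_connectedComponentIn hxK')
  have hpD : p ∉ G.drawing := f.notMem_drawing hpf
  have hpK' : p ∉ G.cutDrawing e J' := fun h => hpD (cutDrawing_subset _ _ h)
  have hpK : p ∉ G.cutDrawing e J := fun h => hpD (cutDrawing_subset _ _ h)
  have hyx : G.arc e t ∈ connectedComponentIn (G.cutDrawing e J')ᶜ (G.arc e s) := by
    refine IsPreconnected.subset_connectedComponentIn (s := G.arc e '' J')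
      (isPreconnected_Ioo.image _ (G.arc_continuous e).continuousOn) (mem_image_of_mem _ ⟨ha's, hb's⟩)
      ?_ (mem_image_of_mem _ ⟨ha't, hb't⟩)
    rintro _ ⟨u, hu, rfl⟩
    rw [mem_compl_iff, arc_mem_cutDrawing_iff (ha0.trans hu.1).ne' (hu.2.trans hb1).ne, not_not]
    exact hu
  have hlog' := hasLog_of_mem_connectedComponentIn hK'.isClosed hpK'
    (connectedComponentIn_eq hpx ▸ hyx)
  -- gluing in the two remaining pieces of the curve
  have hlog_arc : ∀ c d : unitInterval, 0 < c → d < 1 → c ≤ d → t ∉ Icc c d →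
      HasLog (G.arc e '' Icc c d) (fun z => (z - G.arc e t) / (z - p)) := by
    intro c d hc hd hcd htcd
    have hne : ∀ z ∈ G.arc e '' Icc c d, z - p ≠ 0 := by
      rintro _ ⟨u, -, rfl⟩ h
      exact hpD (sub_eq_zero.1 h ▸ arc_mem_drawing e u)
    refine HasLog.of_arc (G.arc_continuous e) (G.arc_injective e) hcd
      (ContinuousOn.div (by fun_prop) (by fun_prop) hne) fun z hz => div_ne_zero ?_ (hne z hz)
    obtain ⟨u, hu, rfl⟩ := hz
    exact sub_ne_zero.2 fun h => htcd (G.arc_injective e h ▸ hu)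
  have hclosed : ∀ c d : unitInterval, IsClosed (G.arc e '' Icc c d) := fun c d =>
    (isCompact_Icc.image (G.arc_continuous e)).isClosed
  -- Each restored subarc meets what is already there in at most one point, so the logarithms glue.
  have h1 : HasLog (G.cutDrawing e J' ∪ G.arc e '' Icc a' a) (fun z => (z - G.arc e t) / (z - p)) := by
    refine HasLog.union hK'.isClosed (hclosed _ _) ?_ hlog'
      (hlog_arc a' a ha0 (htab.1.trans ht1) haa fun h => absurd h.2 (not_le.2 htab.1))
    refine (subsingleton_singleton (a := G.arc e a')).anti ?_ |>.isPreconnected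
    rintro _ ⟨hz, u, hu, rfl⟩
    rw [arc_mem_cutDrawing_iff (ha0.trans_le hu.1).ne'
      (hu.2.trans_lt (htab.1.trans ht1)).ne] at hz
    have : ¬ a' < u := fun h => hz ⟨h, hu.2.trans_lt (htab.1.trans hb't)⟩
    rw [le_antisymm (not_lt.1 this) hu.1]; rfl
  have h2 : HasLog (G.cutDrawing e J' ∪ G.arc e '' Icc a' a ∪ G.arc e '' Icc b b')
      (fun z => (z - G.arc e t) / (z - p)) := by
    refine HasLog.union (hK'.isClosed.union (hclosed _ _)) (hclosed _ _) ?_ h1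
      (hlog_arc b b' (ht0.trans htab.2) hb1 hbb fun h => absurd h.1 (not_le.2 htab.2))
    refine (subsingleton_singleton (a := G.arc e b')).anti ?_ |>.isPreconnected
    rintro _ ⟨hz, u, hu, rfl⟩
    rcases hz with hz | ⟨w, hw, hwu⟩
    · rw [arc_mem_cutDrawing_iff ((ht0.trans htab.2).trans_le hu.1).ne'
        (hu.2.trans_lt hb1).ne] at hz
      have : ¬ u < b' := fun h => hz ⟨(ha't.trans htab.2).trans_le hu.1, h⟩
      rw [le_antisymm hu.2 (not_lt.1 this)]; rfl
    · have := G.arc_injective e hwu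
      subst this
      exact absurd (hu.1.trans hw.2) (not_le.2 (htab.1.trans htab.2))
  have hlog : HasLog (G.cutDrawing e J) (fun z => (z - G.arc e t) / (z - p)) := by
    refine h2.mono ?_
    rintro z (hz | ⟨u, hu, rfl⟩)
    · exact Or.inl (Or.inl (Or.inl hz))
    · by_cases h1 : u ∈ Icc a' a
      · exact Or.inl (Or.inr (mem_image_of_mem _ h1))
      by_cases h2 : u ∈ Icc b b'
      · exact Or.inr (mem_image_of_mem _ h2)
      refine Or.inl (Or.inl (Or.inr (mem_image_of_mem _ fun h3 => ?_)))
      have h4 : a < u := not_le.1 fun h => h1 ⟨h3.1.le, h⟩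
      have h5 : u < b := not_le.1 fun h => h2 ⟨h, h3.2.le⟩
      exact hu ⟨h4, h5⟩
  have hyp := mem_connectedComponentIn_of_hasLog hK hpK hyK hlog
  -- To leave `f`, this component would have to meet the frontier of `f`. That frontier lies in the
  -- drawing and misses the piece over `J`, so it is part of the cut drawing.
  have hsub : connectedComponentIn (G.cutDrawing e J)ᶜ p ⊆ f.1 := by
    refine isPreconnected_connectedComponentIn.subset_of_closure_inter_subset f.isOpen
      ⟨p, mem_connectedComponentIn hpK, hpf⟩ ?_
    rintro z ⟨hz, hz'⟩
    by_contra hzf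
    have hzfr : z ∈ frontier f.1 := by rw [f.isOpen.frontier_eq]; exact ⟨hz, hzf⟩
    rcases drawing_subset_cutDrawing_union e J (f.frontier_subset hzfr) with h | ⟨u, hu, rfl⟩
    · exact connectedComponentIn_subset _ _ hz' h
    · exact (hab hu).1 hzfr
  exact f.notMem_drawing (hsub hyp) (arc_mem_drawing e t)

/-- A face with an interior point of an edge on its boundary is incident to the ends of the edge. -/
theorem incident_of_arc_mem_frontier [Finite V] [Finite E] (f : G.Face) {e : E} {s : unitInterval}
    (hs0 : s ≠ 0) (hs1 : s ≠ 1) (hs : G.arc e s ∈ frontier f.1) :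
    G.Incident (G.src e) f ∧ G.Incident (G.tgt e) f := by
  have hcl : IsClosed (G.arc e ⁻¹' frontier f.1) :=
    isClosed_frontier.preimage (G.arc_continuous e)
  have hsub : closure (Ioo (0 : unitInterval) 1) ⊆ G.arc e ⁻¹' frontier f.1 :=
    hcl.closure_subset_iff.2 fun t ht => arc_mem_frontier_of_arc_mem_frontier f
      (unitInterval.pos_iff_ne_zero.2 hs0) (unitInterval.lt_one_iff_ne_one.2 hs1) ht.1 ht.2 hs
  rw [closure_Ioo zero_ne_one] at hsub
  unfold Incident
  rw [← G.arc_zero, ← G.arc_one]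
  exact ⟨hsub (by simp), hsub (by simp)⟩
-- Drawings of subgraphs
/-- The edges of `G` with both ends in `X`. -/
def inducedEdges (G : PlaneGraph V E) (X : Set V) : Set E :=
  {e | G.src e ∈ X ∧ G.tgt e ∈ X}

/-- The drawing of the subgraph with vertices `X` and edges `F`. -/
def subdrawing (G : PlaneGraph V E) (X : Set V) (F : Set E) : Set ℂ :=
  G.pos '' X ∪ ⋃ e ∈ F, range (G.arc e)

/-- The drawing of the subgraph induced by `X`. -/
def inducedDrawing (G : PlaneGraph V E) (X : Set V) : Set ℂ :=
  G.subdrawing X (G.inducedEdges X)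

theorem isCompact_subdrawing [Finite V] [Finite E] (X : Set V) (F : Set E) :
    IsCompact (G.subdrawing X F) :=
  ((toFinite X).image _).isCompact.union
    ((toFinite F).isCompact_biUnion fun e _ => isCompact_range_arc e)

theorem isCompact_inducedDrawing [Finite V] [Finite E] (X : Set V) :
    IsCompact (G.inducedDrawing X) :=
  isCompact_subdrawing _ _

theorem inducedDrawing_subset (X : Set V) : G.inducedDrawing X ⊆ G.drawing := by
  rintro z (⟨v, -, rfl⟩ | hz)
  · exact pos_mem_drawing v
  · simp only [mem_iUnion] at hz
    obtain ⟨e, -, s, rfl⟩ := hz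
    exact arc_mem_drawing e s

/-- The vertex `u` is an end of the edge `e`. -/
def IsEnd (G : PlaneGraph V E) (e : E) (u : V) : Prop := G.src e = u ∨ G.tgt e = u

theorem isEnd_of_arc_eq_pos {e : E} {s : unitInterval} {u : V} (h : G.arc e s = G.pos u) :
    G.IsEnd e u := by
  rcases G.arc_ne_pos e s u h with rfl | rfl
  · exact Or.inl (G.pos_injective ((G.arc_zero e).symm.trans h))
  · exact Or.inr (G.pos_injective ((G.arc_one e).symm.trans h))

theorem IsEnd.mem_range {e : E} {u : V} (h : G.IsEnd e u) : G.pos u ∈ range (G.arc e) := by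
  rcases h with rfl | rfl
  · exact ⟨0, G.arc_zero e⟩
  · exact ⟨1, G.arc_one e⟩

theorem IsEnd.mem_of_mem_inducedEdges {X : Set V} {e : E} {u : V} (h : G.IsEnd e u)
    (he : e ∈ G.inducedEdges X) : u ∈ X := by
  rcases h with rfl | rfl
  exacts [he.1, he.2]

theorem mem_range_pos_of_mem_arcs {e e' : E} (he : e ≠ e') {z : ℂ} (hz : z ∈ range (G.arc e))
    (hz' : z ∈ range (G.arc e')) : z ∈ range G.pos := by
  obtain ⟨s, rfl⟩ := hz
  obtain ⟨s', hs'⟩ := hz'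
  rcases G.arc_disjoint e e' s s' he hs'.symm with rfl | rfl
  · exact ⟨_, (G.arc_zero e).symm⟩
  · exact ⟨_, (G.arc_one e).symm⟩

theorem pos_mem_inducedDrawing_iff {X : Set V} {u : V} : G.pos u ∈ G.inducedDrawing X ↔ u ∈ X := by
  constructor
  · rintro (⟨v, hv, h⟩ | hz)
    · exact G.pos_injective h ▸ hv
    · simp only [mem_iUnion] at hz
      obtain ⟨e, he, s, hs⟩ := hz
      exact (isEnd_of_arc_eq_pos hs).mem_of_mem_inducedEdges he
  · exact fun h => Or.inl (mem_image_of_mem _ h)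

theorem exists_isEnd_notMem {X : Set V} {e : E} {z : ℂ} (hz : z ∈ range (G.arc e))
    (hzX : z ∉ G.inducedDrawing X) : ∃ u, G.IsEnd e u ∧ u ∉ X := by
  by_contra! h
  exact hzX (Or.inr (mem_biUnion (x := e) ⟨h _ (Or.inl rfl), h _ (Or.inr rfl)⟩ hz))

/-! ### Plane components off `G[X]` versus walks in the radial completion avoiding `X` -/

/-- Reachability in the radial completion by walks avoiding the vertices in `X`. -/
def RadialConn (G : PlaneGraph V E) (X : Set V) (a b : V ⊕ G.Face) : Prop :=
  ∃ p : G.radialCompletion.Walk a b, ∀ u, Sum.inl u ∈ p.support → u ∉ X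

namespace RadialConn

variable {X : Set V} {a b c : V ⊕ G.Face}

theorem symm (h : G.RadialConn X a b) : G.RadialConn X b a := by
  obtain ⟨p, hp⟩ := h
  exact ⟨p.reverse, fun u hu => hp u (by simpa using hu)⟩

theorem trans (h : G.RadialConn X a b) (h' : G.RadialConn X b c) : G.RadialConn X a c := by
  obtain ⟨p, hp⟩ := h
  obtain ⟨q, hq⟩ := h'
  refine ⟨p.append q, fun u hu => ?_⟩
  rcases (SimpleGraph.Walk.mem_support_append_iff _ _).1 hu with h | h
  exacts [hp u h, hq u h]

theorem refl (h : ∀ u, Sum.inl u = a → u ∉ X) : G.RadialConn X a a :=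
  ⟨.nil, fun u hu => h u (by simpa using hu)⟩

theorem of_adj (hab : G.radialCompletion.Adj a b) (ha : ∀ u, Sum.inl u = a → u ∉ X)
    (hb : ∀ u, Sum.inl u = b → u ∉ X) : G.RadialConn X a b :=
  ⟨hab.toWalk, fun u hu => by
    simp only [SimpleGraph.Walk.support_cons, SimpleGraph.Walk.support_nil, List.mem_cons,
      List.not_mem_nil, or_false] at hu
    rcases hu with h | h
    exacts [ha u h, hb u h]⟩

theorem of_isEnd {e : E} {u v : V} (hu : G.IsEnd e u) (hv : G.IsEnd e v) (huX : u ∉ X)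
    (hvX : v ∉ X) : G.RadialConn X (Sum.inl u) (Sum.inl v) := by
  by_cases huv : u = v
  · subst huv
    exact refl fun w hw => Sum.inl_injective hw ▸ huX
  · refine of_adj (show G.toSimpleGraph.Adj u v from ⟨huv, e, ?_⟩)
      (fun w hw => Sum.inl_injective hw ▸ huX) (fun w hw => Sum.inl_injective hw ▸ hvX)
    rcases hu with hu | hu <;> rcases hv with hv | hv
    · exact absurd (hu.symm.trans hv) huv
    · exact Or.inl ⟨hu, hv⟩
    · exact Or.inr ⟨hv, hu⟩
    · exact absurd (hu.symm.trans hv) huv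

theorem of_incident {u : V} {f : G.Face} (h : G.Incident u f) (huX : u ∉ X) :
    G.RadialConn X (Sum.inl u) (Sum.inr f) :=
  of_adj h (fun w hw => Sum.inl_injective hw ▸ huX) (fun w hw => by cases hw)

end RadialConn

/-- The point `z` belongs to the vertex `a` of the radial completion, which is not in `X`: it is a
point of a face, the point of a vertex, or a point of an edge incident to a vertex. -/
inductive Labels (G : PlaneGraph V E) (X : Set V) (z : ℂ) : V ⊕ G.Face → Prop
  | face (f : G.Face) (h : z ∈ f.1) : Labels G X z (Sum.inr f)
  | vertex (u : V) (hu : u ∉ X) (h : z = G.pos u) : Labels G X z (Sum.inl u)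
  | edge (u : V) (hu : u ∉ X) (e : E) (he : G.IsEnd e u) (h : z ∈ range (G.arc e)) :
      Labels G X z (Sum.inl u)

variable {X : Set V} {z w : ℂ} {a b : V ⊕ G.Face}

theorem Labels.notMem {u : V} (h : G.Labels X z (Sum.inl u)) : u ∉ X := by
  cases h <;> assumption

theorem Labels.mem_drawing {u : V} (h : G.Labels X z (Sum.inl u)) : z ∈ G.drawing := by
  cases h with
  | vertex _ _ h => subst h; exact pos_mem_drawing u
  | edge _ _ e he h => obtain ⟨s, rfl⟩ := h; exact arc_mem_drawing e s

theorem exists_labels (hz : z ∉ G.inducedDrawing X) : ∃ a, G.Labels X z a := by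
  by_cases hd : z ∈ G.drawing
  · rcases hd with ⟨u, rfl⟩ | hd
    · exact ⟨_, .vertex u (fun h => hz (pos_mem_inducedDrawing_iff.2 h)) rfl⟩
    · obtain ⟨e, he⟩ := mem_iUnion.1 hd
      obtain ⟨u, hu, huX⟩ := exists_isEnd_notMem he hz
      exact ⟨_, .edge u huX e hu he⟩
  · obtain ⟨f, hf⟩ := exists_face hd
    exact ⟨_, .face f hf⟩

theorem Labels.radialConn_pos {u v : V} (h : G.Labels X (G.pos v) (Sum.inl u)) (hv : v ∉ X) :
    G.RadialConn X (Sum.inl v) (Sum.inl u) := by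
  cases h with
  | vertex _ hu h =>
    rw [G.pos_injective h]
    exact .refl fun w hw => Sum.inl_injective hw ▸ hu
  | edge _ hu e he h =>
    obtain ⟨s, hs⟩ := h
    exact .of_isEnd (isEnd_of_arc_eq_pos hs) he hv hu

/-- A point with several labels is either on an edge, whose ends outside `X` are adjacent, or at a
vertex outside `X`, which is equal or adjacent to each of its labels. -/
theorem Labels.radialConn (hz : z ∉ G.inducedDrawing X) (ha : G.Labels X z a)
    (hb : G.Labels X z b) : G.RadialConn X a b := by
  rcases a with u | f <;> rcases b with v | f'
  · by_cases hp : z ∈ range G.pos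
    · obtain ⟨w, rfl⟩ := hp
      have hw : w ∉ X := fun h => hz (pos_mem_inducedDrawing_iff.2 h)
      exact (ha.radialConn_pos hw).symm.trans (hb.radialConn_pos hw)
    · cases ha with
      | vertex _ _ h => exact absurd ⟨u, h.symm⟩ hp
      | edge _ hu e he h =>
        cases hb with
        | vertex _ _ h => exact absurd ⟨v, h.symm⟩ hp
        | edge _ hv e' he' h' =>
          by_cases hee : e = e'
          · subst hee
            exact .of_isEnd he he' hu hv
          · exact absurd (mem_range_pos_of_mem_arcs hee h h') hp
  · cases hb with | face _ h => exact absurd ha.mem_drawing (f'.notMem_drawing h)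
  · cases ha with | face _ h => exact absurd hb.mem_drawing (f.notMem_drawing h)
  · cases ha with | face _ h => cases hb with | face _ h' =>
      rw [Face.eq_of_mem h h']
      exact .refl fun w hw => by cases hw

theorem exists_ball_local [Finite V] [Finite E] (G : PlaneGraph V E) (z : ℂ) :
    ∃ r > 0, (∀ u, G.pos u ∈ Metric.ball z r → z = G.pos u) ∧
      (∀ e, (Metric.ball z r ∩ range (G.arc e)).Nonempty → z ∈ range (G.arc e)) := by
  have h1 : ∀ᶠ w in 𝓝 z, ∀ u, w = G.pos u → z = G.pos u := by
    rw [Filter.eventually_all]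
    intro u
    by_cases h : z = G.pos u
    · simp [h]
    · filter_upwards [isOpen_ne.mem_nhds h] with w hw hw'
      exact absurd hw' hw
  have h2 : ∀ᶠ w in 𝓝 z, ∀ e, w ∈ range (G.arc e) → z ∈ range (G.arc e) := by
    rw [Filter.eventually_all]
    intro e
    by_cases h : z ∈ range (G.arc e)
    · simp only [h, implies_true, Filter.eventually_true]
    · filter_upwards [(isCompact_range_arc e).isClosed.isOpen_compl.mem_nhds h] with w hw hw'
      exact absurd hw' hw
  obtain ⟨r, hr, hball⟩ := Metric.eventually_nhds_iff_ball.1 (h1.and h2)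
  exact ⟨r, hr, fun u hu => (hball _ hu).1 u rfl, fun e ⟨w, hw, hwe⟩ => (hball w hw).2 e hwe⟩

/-- Labels are locally constant up to connection. A small ball around `z` meets only vertices and
edges through `z`. If it meets a face not containing `z`, it contains a frontier point of this face,
on a vertex or edge through `z`; `incident_of_arc_mem_frontier` then makes a label of `z` incident
to the face. -/
theorem eventually_radialConn_of_labels [Finite V] [Finite E] (hz : z ∉ G.inducedDrawing X) :
    ∀ᶠ w in 𝓝 z, ∀ a b, G.Labels X z a → G.Labels X w b → G.RadialConn X a b := by
  obtain ⟨r, hr, hpos, harc⟩ := exists_ball_local G z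
  filter_upwards [Metric.ball_mem_nhds z hr] with w hw a b ha hb
  cases hb with
  | vertex u hu h => exact ha.radialConn hz (.vertex u hu (hpos u (h ▸ hw)))
  | edge u hu e he h => exact ha.radialConn hz (.edge u hu e he (harc e ⟨w, hw, h⟩))
  | face f hf =>
    by_cases hzf : z ∈ f.1
    · exact ha.radialConn hz (.face f hzf)
    have hfr : ∃ y ∈ Metric.ball z r, y ∈ frontier f.1 := by
      by_contra! h
      refine hzf ((convex_ball z r).isPreconnected.subset_of_closure_inter_subset f.isOpen
        ⟨w, hw, hf⟩ ?_ (Metric.mem_ball_self hr))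
      rintro y ⟨hy, hyb⟩
      by_contra hyf
      exact h y hyb (by rw [f.isOpen.frontier_eq]; exact ⟨hy, hyf⟩)
    obtain ⟨y, hyb, hy⟩ := hfr
    by_cases hyp : y ∈ range G.pos
    · obtain ⟨u, rfl⟩ := hyp
      have hzu := hpos u hyb
      have hu : u ∉ X := fun h => hz (hzu ▸ pos_mem_inducedDrawing_iff.2 h)
      exact (ha.radialConn hz (.vertex u hu hzu)).trans (.of_incident hy hu)
    · obtain h | h := f.frontier_subset hy
      · exact absurd h hyp
      obtain ⟨e, s, rfl⟩ := mem_iUnion.1 h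
      have hze := harc e ⟨_, hyb, mem_range_self s⟩
      obtain ⟨u, hu, huX⟩ := exists_isEnd_notMem hze hz
      have hinc := incident_of_arc_mem_frontier f (e := e) (s := s)
        (fun h => hyp ⟨_, by rw [h, G.arc_zero]⟩) (fun h => hyp ⟨_, by rw [h, G.arc_one]⟩) hy
      have hinc' : G.Incident u f := by
        rcases hu with rfl | rfl
        exacts [hinc.1, hinc.2]
      exact (ha.radialConn hz (.edge u huX e hu hze)).trans (.of_incident hinc' huX)

/-- Two vertices of the radial completion that are drawn in the same component of the complement of
an induced subgraph are connected off this subgraph. -/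
theorem radialConn_of_mem_connectedComponentIn [Finite V] [Finite E]
    (hz : z ∉ G.inducedDrawing X) (hw : w ∈ connectedComponentIn (G.inducedDrawing X)ᶜ z)
    (ha : G.Labels X z a) (hb : G.Labels X w b) : G.RadialConn X a b := by
  have hsub := connectedComponentIn_subset (G.inducedDrawing X)ᶜ z
  refine IsPreconnected.induction₂' (s := connectedComponentIn (G.inducedDrawing X)ᶜ z)
    isPreconnected_connectedComponentIn
    (fun x y => ∀ a b, G.Labels X x a → G.Labels X y b → G.RadialConn X a b)
    (fun x hx => ?_) (fun x y t hx hy ht h1 h2 a b ha hb => ?_)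
    (mem_connectedComponentIn hz) hw a b ha hb
  · filter_upwards [mem_nhdsWithin_of_mem_nhds (eventually_radialConn_of_labels (hsub hx))]
      with y hy
    exact ⟨hy, fun a b ha hb => (hy b a hb ha).symm⟩
  · obtain ⟨c, hc⟩ := exists_labels (hsub hy)
    exact (h1 a c ha hc).trans (h2 c b hc hb)

/-- The point `z` represents the vertex `a` of the radial completion. -/
def Represents (G : PlaneGraph V E) (z : ℂ) : V ⊕ G.Face → Prop
  | Sum.inl u => z = G.pos u
  | Sum.inr f => z ∈ f.1

theorem exists_represents (a : V ⊕ G.Face) : ∃ z, G.Represents z a := by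
  rcases a with u | f
  exacts [⟨_, rfl⟩, f.nonempty]

theorem Represents.notMem (h : G.Represents z a) (ha : ∀ u, Sum.inl u = a → u ∉ X) :
    z ∉ G.inducedDrawing X := by
  rcases a with u | f
  · obtain rfl : z = _ := h
    rw [pos_mem_inducedDrawing_iff]
    exact ha u rfl
  · exact fun hz => f.notMem_drawing h (inducedDrawing_subset X hz)

theorem Represents.labels (h : G.Represents z a) (ha : ∀ u, Sum.inl u = a → u ∉ X) :
    G.Labels X z a := by
  rcases a with u | f
  exacts [.vertex u (ha u rfl) h, .face f h]

theorem Represents.mem_connectedComponentIn_of_inr {f : G.Face} (hz : z ∈ f.1) (hw : w ∈ f.1) :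
    w ∈ connectedComponentIn (G.inducedDrawing X)ᶜ z :=
  f.isPreconnected.subset_connectedComponentIn hz
    (fun _ hx h => f.notMem_drawing hx (inducedDrawing_subset X h)) hw

theorem mem_connectedComponentIn_of_incident {u : V} {f : G.Face} (h : G.Incident u f)
    (hu : u ∉ X) (hz : z ∈ f.1) : G.pos u ∈ connectedComponentIn (G.inducedDrawing X)ᶜ z := by
  have hcl : G.pos u ∈ closure f.1 := frontier_subset_closure h
  refine IsPreconnected.subset_connectedComponentIn (s := insert (G.pos u) f.1)
    (f.isPreconnected.subset_closure (subset_insert _ _) (insert_subset hcl subset_closure))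
    (Or.inr hz) ?_ (Or.inl rfl)
  rintro x (rfl | hx)
  · rwa [mem_compl_iff, pos_mem_inducedDrawing_iff]
  · exact fun h => f.notMem_drawing hx (inducedDrawing_subset X h)

theorem arc_notMem_inducedDrawing {e : E} {s : unitInterval} (h : ∀ u, G.IsEnd e u → u ∉ X) :
    G.arc e s ∉ G.inducedDrawing X := by
  rintro (⟨v, hv, hs⟩ | hz)
  · exact h v (isEnd_of_arc_eq_pos hs.symm) hv
  · simp only [mem_iUnion] at hz
    obtain ⟨e', he', hs⟩ := hz
    by_cases hee : e = e'
    · subst hee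
      exact h _ (Or.inl rfl) he'.1
    · obtain ⟨v, hv⟩ := mem_range_pos_of_mem_arcs hee (mem_range_self s) hs
      refine h v (isEnd_of_arc_eq_pos hv.symm) ?_
      obtain ⟨s', hs'⟩ := hs
      exact (isEnd_of_arc_eq_pos (hs'.trans hv.symm)).mem_of_mem_inducedEdges he'

theorem arc_mem_connectedComponentIn {e : E} {u : V} (h : ∀ u, G.IsEnd e u → u ∉ X)
    (hu : G.IsEnd e u) (s : unitInterval) :
    G.arc e s ∈ connectedComponentIn (G.inducedDrawing X)ᶜ (G.pos u) :=
  (isPreconnected_range (G.arc_continuous e)).subset_connectedComponentIn hu.mem_range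
    (by rintro _ ⟨t, rfl⟩; exact arc_notMem_inducedDrawing h) (mem_range_self s)

/-- Vertices of the radial completion that are connected off an induced subgraph are drawn in the
same component of the complement of this subgraph. -/
theorem RadialConn.mem_connectedComponentIn (h : G.RadialConn X a b) (hz : G.Represents z a)
    (hw : G.Represents w b) : w ∈ connectedComponentIn (G.inducedDrawing X)ᶜ z := by
  obtain ⟨p, hp⟩ := h
  induction p generalizing z with
  | @nil a =>
    rcases a with u | f
    · obtain rfl : z = _ := hz
      obtain rfl : w = _ := hw
      exact _root_.mem_connectedComponentIn
        ((pos_mem_inducedDrawing_iff (X := X)).not.2 (hp u (by simp)))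
    · exact Represents.mem_connectedComponentIn_of_inr hz hw
  | @cons a c b hac p ih =>
    obtain ⟨y, hy⟩ := exists_represents c
    have h1 := ih hy hw (fun u hu => hp u (by simp [hu]))
    suffices h : y ∈ connectedComponentIn (G.inducedDrawing X)ᶜ z by
      rwa [connectedComponentIn_eq h]
    have hzX : z ∉ G.inducedDrawing X := hz.notMem fun u hu => hp u (by simp [hu])
    have hc : ∀ u, Sum.inl u = c → u ∉ X := fun u hu => hp u (by simp [hu])
    rcases a with u | f <;> rcases c with v | f'
    · obtain rfl : z = _ := hz
      obtain rfl : y = _ := hy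
      have hu : u ∉ X := hp u (by simp)
      obtain ⟨e, he⟩ := (show G.toSimpleGraph.Adj u v from hac).2
      have hend : ∀ x, G.IsEnd e x → x ∉ X := by
        rcases he with ⟨h1, h2⟩ | ⟨h1, h2⟩ <;> rintro x (hx | hx) <;>
          rw [← hx] <;> simp only [h1, h2] <;> first | exact hu | exact hc v rfl
      have heu : G.IsEnd e u := he.imp And.left And.right
      have hev : G.IsEnd e v := he.symm.imp And.left And.right
      obtain ⟨s, hs⟩ := hev.mem_range
      rw [← hs]
      exact arc_mem_connectedComponentIn hend heu s
    · obtain rfl : z = _ := hz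
      have := mem_connectedComponentIn_of_incident (X := X) (show G.Incident u f' from hac)
        (hp u (by simp)) hy
      rw [← connectedComponentIn_eq this]
      exact _root_.mem_connectedComponentIn (hy.notMem hc)
    · obtain rfl : y = _ := hy
      exact mem_connectedComponentIn_of_incident (show G.Incident v f from hac) (hc v rfl) hz
    · exact hac.elim
-- A separating subgraph contains a separating cycle
namespace Cycle

theorem isCompact_carrier (C : G.Cycle) : IsCompact C.carrier := by
  have : NeZero C.len := ⟨by have := C.two_le_len; omega⟩
  exact isCompact_iUnion fun i => isCompact_range_arc _

theorem carrier_subset {X : Set V} {C : G.Cycle} (h : ∀ i, C.edge i ∈ G.inducedEdges X) :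
    C.carrier ⊆ G.inducedDrawing X :=
  iUnion_subset fun i => (subset_biUnion_of_mem (u := fun e => range (G.arc e)) (h i)).trans
    subset_union_right

end Cycle

theorem src_ne_tgt (e : E) : G.src e ≠ G.tgt e := fun h =>
  zero_ne_one (G.arc_injective e ((G.arc_zero e).trans (h ▸ (G.arc_one e).symm)))

theorem Joins.eq_or_eq {e : E} {a b c d : V} (h : G.Joins e a b) (h' : G.Joins e c d) :
    (a = c ∧ b = d) ∨ (a = d ∧ b = c) := by
  rcases h with ⟨rfl, rfl⟩ | ⟨rfl, rfl⟩ <;> rcases h' with ⟨rfl, rfl⟩ | ⟨rfl, rfl⟩ <;> simp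

/-- A path together with an edge that joins its ends and is not on the path is a cycle. -/
theorem exists_cycle_of_path {n : ℕ} (hn : 1 ≤ n) {x : ℕ → V} (hx : InjOn x {i | i ≤ n})
    {ε : ℕ → E} (hε : ∀ i < n, G.Joins (ε i) (x i) (x (i + 1))) {e : E}
    (he : G.Joins e (x n) (x 0)) (hne : ∀ i < n, ε i ≠ e) :
    ∃ C : G.Cycle, (∀ i, C.edge i = e ∨ ∃ j < n, C.edge i = ε j) ∧
      (∀ j < n, range (G.arc (ε j)) ⊆ C.carrier) ∧ range (G.arc e) ⊆ C.carrier := by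
  classical
  -- The last index `n` carries the closing edge `e`.
  let edge : ZMod (n + 1) → E := fun i => if i.val < n then ε i.val else e
  have hlt : ∀ i : ZMod (n + 1), i.val ≤ n := fun i => Nat.lt_succ_iff.1 (ZMod.val_lt i)
  have hval : ∀ j ≤ n, ((j : ZMod (n + 1))).val = j := fun j hj =>
    ZMod.val_cast_of_lt (Nat.lt_succ_of_le hj)
  have hedge_inj : ∀ i j, i < n → j < n → ε i = ε j → i = j := by
    intro i j hi hj h
    rcases (hε i hi).eq_or_eq (h ▸ hε j hj) with ⟨h1, -⟩ | ⟨h1, h2⟩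
    · exact hx hi.le hj.le h1
    · have h1 := hx (show i ≤ n from hi.le) (show j + 1 ≤ n from hj) h1
      have h2 := hx (show i + 1 ≤ n from hi) (show j ≤ n from hj.le) h2
      omega
  let C : G.Cycle :=
    { len := n + 1
      two_le_len := by omega
      vert := fun i => x i.val
      edge := edge
      vert_injective := fun i j h => ZMod.val_injective _ (hx (hlt i) (hlt j) h)
      edge_injective := by
        intro i j h
        apply ZMod.val_injective
        simp only [edge] at h
        split_ifs at h with h1 h2 h2
        · exact hedge_inj _ _ h1 h2 h
        · exact absurd h (hne _ h1)
        · exact absurd h.symm (hne _ h2)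
        · have := hlt i
          have := hlt j
          omega
      joins := by
        intro i
        simp only [edge]
        split_ifs with h
        · have h1 : (i + 1).val = i.val + 1 := by
            rw [← hval (i.val + 1) h, Nat.cast_add, ZMod.natCast_zmod_val, Nat.cast_one]
          rw [h1]
          exact hε _ h
        · have h1 : i.val = n := le_antisymm (hlt i) (not_lt.1 h)
          have h2 : i + 1 = 0 := by
            rw [← ZMod.natCast_zmod_val i, h1]
            exact_mod_cast ZMod.natCast_self (n + 1)
          rw [h2, h1, ZMod.val_zero]
          exact he }
  refine ⟨C, fun i => ?_, fun j hj => ?_, ?_⟩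
  · change edge i = e ∨ _
    by_cases h : ZMod.val i < n
    · exact Or.inr ⟨_, h, if_pos h⟩
    · exact Or.inl (if_neg h)
  · have : C.edge (j : ZMod (n + 1)) = ε j := by
      change edge _ = _
      simp only [edge, hval j hj.le, hj, if_true]
    rw [← this]
    exact subset_iUnion (fun i => range (G.arc (C.edge i))) _
  · have : C.edge (n : ZMod (n + 1)) = e := by
      change edge _ = _
      simp only [edge, hval n le_rfl, lt_irrefl, if_false]
    conv_lhs => rw [← this]
    exact subset_iUnion (fun i => range (G.arc (C.edge i))) _

/-- The simple graph formed by the edges in `F`. -/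
def edgeGraph (G : PlaneGraph V E) (F : Set E) : SimpleGraph V where
  Adj u v := u ≠ v ∧ ∃ e ∈ F, G.Joins e u v
  symm := ⟨fun _ _ h => ⟨h.1.symm, h.2.imp fun _ he => ⟨he.1, Or.symm he.2⟩⟩⟩
  loopless := ⟨fun _ h => h.1 rfl⟩

theorem subdrawing_insert (X : Set V) (F : Set E) (e : E) :
    G.subdrawing X (insert e F) = G.subdrawing X F ∪ range (G.arc e) := by
  unfold subdrawing
  rw [biUnion_insert, union_assoc, union_comm (range (G.arc e))]

/-- Distinct curves meet only at common ends. This identifies the overlaps in the edge-by-edge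
gluing. -/
theorem exists_isEnd_of_mem_subdrawing {X : Set V} {F : Set E} {e : E} (he : e ∉ F)
    (hF : F ⊆ G.inducedEdges X) {z : ℂ} (hz : z ∈ G.subdrawing X F) (hze : z ∈ range (G.arc e)) :
    ∃ u ∈ X, G.IsEnd e u ∧ z = G.pos u := by
  obtain ⟨s, rfl⟩ := hze
  rcases hz with ⟨u, hu, h⟩ | hz
  · exact ⟨u, hu, isEnd_of_arc_eq_pos h.symm, h.symm⟩
  · simp only [mem_iUnion] at hz
    obtain ⟨e', he', hs⟩ := hz
    obtain ⟨u, hu⟩ := mem_range_pos_of_mem_arcs (fun h : e = e' => he (h.symm ▸ he'))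
      (mem_range_self s) hs
    obtain ⟨s', hs'⟩ := hs
    exact ⟨u, (isEnd_of_arc_eq_pos (hs'.trans hu.symm)).mem_of_mem_inducedEdges (hF he'),
      isEnd_of_arc_eq_pos hu.symm, hu.symm⟩

theorem hasLog_range_arc (e : E) {f : ℂ → ℂ} (hf : ContinuousOn f (range (G.arc e)))
    (h0 : ∀ z ∈ range (G.arc e), f z ≠ 0) : HasLog (range (G.arc e)) f := by
  have h : range (G.arc e) = G.arc e '' Icc 0 1 := by
    rw [← image_univ]
    congr 1
    ext s
    simp [unitInterval.le_one']
  rw [h] at hf h0 ⊢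
  exact HasLog.of_arc (G.arc_continuous e) (G.arc_injective e) zero_le_one hf h0

/-- Adding an edge between two components. -/
theorem hasLog_insert_of_not_reachable [Finite V] [Finite E] {X : Set V} {F : Set E} {e : E}
    (hF : F ⊆ G.inducedEdges X) {f : ℂ → ℂ}
    (he : HasLog (range (G.arc e)) f) (hlog : HasLog (G.subdrawing X F) f)
    (hr : ¬ (G.edgeGraph F).Reachable (G.src e) (G.tgt e)) :
    HasLog (G.subdrawing X (insert e F)) f := by
  -- `A` is the component of `src e`. The new curve meets the drawing over `A` at most in `src e`
  -- and the rest at most in `tgt e`, so two gluings along at most one point suffice.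
  set A : Set V := {x | (G.edgeGraph F).Reachable (G.src e) x} with hA
  have hAe : ∀ e' ∈ F, (G.src e' ∈ A ↔ G.tgt e' ∈ A) := fun e' he' => by
    have hadj : (G.edgeGraph F).Adj (G.src e') (G.tgt e') :=
      ⟨src_ne_tgt e', e', he', Or.inl ⟨rfl, rfl⟩⟩
    exact ⟨fun h => SimpleGraph.Reachable.trans h hadj.reachable,
      fun h => SimpleGraph.Reachable.trans h hadj.symm.reachable⟩
  have heF : e ∉ F := fun h => hr ((hAe e h).1 (SimpleGraph.Reachable.refl _))
  set F₁ : Set E := {e' ∈ F | G.src e' ∈ A}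
  set F₂ : Set E := {e' ∈ F | G.src e' ∉ A}
  have hF₁ : F₁ ⊆ G.inducedEdges (X ∩ A) := fun e' h =>
    ⟨⟨(hF h.1).1, h.2⟩, ⟨(hF h.1).2, (hAe e' h.1).1 h.2⟩⟩
  have hF₂ : F₂ ⊆ G.inducedEdges (X \ A) := fun e' h =>
    ⟨⟨(hF h.1).1, h.2⟩, ⟨(hF h.1).2, fun h' => h.2 ((hAe e' h.1).2 h')⟩⟩
  have hsub : ∀ (Y : Set V) (F' : Set E), Y ⊆ X → F' ⊆ F →
      G.subdrawing Y F' ⊆ G.subdrawing X F := fun Y F' hY hF' =>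
    union_subset_union (image_mono hY) (biUnion_subset_biUnion_left hF')
  have hdisj : ∀ z ∈ G.subdrawing (X ∩ A) F₁, z ∉ G.subdrawing (X \ A) F₂ := by
    intro z hz hz'
    rcases hz with ⟨u, hu, rfl⟩ | hz
    · rcases hz' with ⟨v, hv, h⟩ | hz'
      · exact hv.2 (G.pos_injective h ▸ hu.2)
      · simp only [mem_iUnion] at hz'
        obtain ⟨e', he', s, hs⟩ := hz'
        exact ((isEnd_of_arc_eq_pos hs).mem_of_mem_inducedEdges (hF₂ he')).2 hu.2
    · simp only [mem_iUnion] at hz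
      obtain ⟨e', he', hs⟩ := hz
      obtain ⟨u, hu, hend, -⟩ := exists_isEnd_of_mem_subdrawing
        (fun h => h.2 he'.2 : e' ∉ F₂) hF₂ hz' hs
      exact hu.2 (hend.mem_of_mem_inducedEdges (hF₁ he')).2
  have h1 : HasLog (G.subdrawing (X ∩ A) F₁ ∪ range (G.arc e)) f := by
    refine HasLog.union (isCompact_subdrawing _ _).isClosed (isCompact_range_arc e).isClosed ?_
      (hlog.mono (hsub _ _ inter_subset_left fun _ h => h.1)) he
    refine (subsingleton_singleton (a := G.pos (G.src e))).anti ?_ |>.isPreconnected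
    rintro z ⟨hz, hze⟩
    obtain ⟨u, hu, rfl | rfl, rfl⟩ :=
      exists_isEnd_of_mem_subdrawing (fun h => heF h.1) hF₁ hz hze
    · rfl
    · exact absurd hu.2 hr
  have h2 : HasLog (G.subdrawing (X ∩ A) F₁ ∪ range (G.arc e) ∪ G.subdrawing (X \ A) F₂) f := by
    refine HasLog.union ((isCompact_subdrawing _ _).isClosed.union
      (isCompact_range_arc e).isClosed) (isCompact_subdrawing _ _).isClosed ?_ h1
      (hlog.mono (hsub _ _ sdiff_subset fun _ h => h.1))
    refine (subsingleton_singleton (a := G.pos (G.tgt e))).anti ?_ |>.isPreconnected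
    rintro z ⟨hz | hz, hz'⟩
    · exact absurd hz' (hdisj z hz)
    · obtain ⟨u, hu, rfl | rfl, rfl⟩ :=
        exists_isEnd_of_mem_subdrawing (fun h => heF h.1) hF₂ hz' hz
      · exact absurd (SimpleGraph.Reachable.refl _) hu.2
      · rfl
  refine h2.mono ?_
  rw [subdrawing_insert]
  rintro z ((⟨u, hu, rfl⟩ | hz) | hz)
  · by_cases huA : u ∈ A
    · exact Or.inl (Or.inl (Or.inl (mem_image_of_mem _ ⟨hu, huA⟩)))
    · exact Or.inr (Or.inl (mem_image_of_mem _ ⟨hu, huA⟩))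
  · simp only [mem_iUnion] at hz
    obtain ⟨e', he', hz⟩ := hz
    by_cases hA' : G.src e' ∈ A
    · exact Or.inl (Or.inl (Or.inr (mem_biUnion (x := e') ⟨he', hA'⟩ hz)))
    · exact Or.inr (Or.inr (mem_biUnion (x := e') ⟨he', hA'⟩ hz))
  · exact Or.inl (Or.inr hz)

/-- Adding an edge that closes a cycle. -/
theorem hasLog_insert_of_reachable [Finite V] [Finite E] {X : Set V} {F : Set E} {e : E}
    (heF : e ∉ F) (hF : F ⊆ G.inducedEdges X) {f : ℂ → ℂ} (hlog : HasLog (G.subdrawing X F) f)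
    (hC : ∀ C : G.Cycle, (∀ i, C.edge i ∈ insert e F) → HasLog C.carrier f)
    (hr : (G.edgeGraph F).Reachable (G.src e) (G.tgt e)) :
    HasLog (G.subdrawing X (insert e F)) f := by
  obtain ⟨p, hp⟩ := hr.exists_isPath
  have hlen : 1 ≤ p.length := by
    rcases Nat.eq_zero_or_pos p.length with h | h
    · exact absurd (SimpleGraph.Walk.eq_of_length_eq_zero h) (src_ne_tgt e)
    · exact h
  have hadj : ∀ i : ℕ, ∃ e', i < p.length →
      e' ∈ F ∧ G.Joins e' (p.getVert i) (p.getVert (i + 1)) := fun i => by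
    by_cases hi : i < p.length
    · obtain ⟨-, e', h⟩ := p.adj_getVert_succ hi
      exact ⟨e', fun _ => h⟩
    · exact ⟨e, fun h => absurd h hi⟩
  choose ε hε using hadj
  obtain ⟨C, hCe, hCε, hCr⟩ := exists_cycle_of_path hlen hp.getVert_injOn
    (fun i hi => (hε i hi).2) (e := e)
    (by rw [p.getVert_length, p.getVert_zero]; exact Or.inr ⟨rfl, rfl⟩)
    (fun i hi h => heF (h ▸ (hε i hi).1))
  obtain ⟨m, hm, hm'⟩ := hC C fun i => by
    rcases hCe i with h | ⟨j, hj, h⟩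
    · exact h ▸ mem_insert _ _
    · exact h ▸ mem_insert_of_mem _ (hε j hj).1
  obtain ⟨l, hl, hl'⟩ := hlog
  -- `l` and the logarithm `m` on the cycle differ by the same constant at all vertices of the path.
  -- Hence `m`, shifted by this constant, agrees with `l` at both ends of `e`.
  have hstep : ∀ i ≤ p.length, l (G.pos (p.getVert i)) - m (G.pos (p.getVert i)) =
      l (G.pos (G.src e)) - m (G.pos (G.src e)) := by
    intro i
    induction i with
    | zero => intro _; rw [p.getVert_zero]
    | succ i ih =>
      intro hi
      rw [← ih (Nat.le_of_succ_le hi)]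
      have hsubF : range (G.arc (ε i)) ⊆ G.subdrawing X F :=
        (subset_biUnion_of_mem (u := fun e => range (G.arc e)) (hε i hi).1).trans
          subset_union_right
      refine (isPreconnected_range (G.arc_continuous (ε i))).eq_of_exp_eq (hl.mono hsubF)
        (hm.mono (hCε i hi)) (fun z hz => by rw [hl' z (hsubF hz), hm' z (hCε i hi hz)]) ?_ ?_
      · exact IsEnd.mem_range ((hε i hi).2.symm.imp And.left And.right)
      · exact IsEnd.mem_range ((hε i hi).2.imp And.left And.right)
  have hsrc : G.pos (G.src e) ∈ range (G.arc e) := IsEnd.mem_range (Or.inl rfl)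
  rw [subdrawing_insert]
  refine HasLog.union_of_eqOn (m := fun z => m z + (l (G.pos (G.src e)) - m (G.pos (G.src e))))
    (isCompact_subdrawing _ _).isClosed (isCompact_range_arc e).isClosed hl hl'
    ((hm.mono hCr).add continuousOn_const) (fun z hz => ?_) ?_
  · have hsrcX : G.pos (G.src e) ∈ G.subdrawing X F := by
      obtain ⟨-, h⟩ := hε 0 hlen
      rw [p.getVert_zero] at h
      have hend : G.IsEnd (ε 0) (G.src e) := h.imp And.left And.right
      exact Or.inr (mem_biUnion (x := ε 0) (hε 0 hlen).1 hend.mem_range)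
    rw [Complex.exp_add, Complex.exp_sub, hl' _ hsrcX, hm' _ (hCr hsrc), ← hm' _ (hCr hsrc),
      div_self (Complex.exp_ne_zero _), mul_one, hm' z (hCr hz)]
  · rintro z ⟨hz, hze⟩
    obtain ⟨u, -, rfl | rfl, rfl⟩ := exists_isEnd_of_mem_subdrawing heF hF hz hze
    · ring
    · have := hstep p.length le_rfl
      rw [p.getVert_length] at this
      rw [← this]; ring

/-- A nowhere vanishing continuous function with a logarithm on every cycle of a plane graph has a
logarithm on the whole drawing. -/
theorem hasLog_subdrawing [Finite V] [Finite E] {X : Set V} {F : Set E}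
    (hF : F ⊆ G.inducedEdges X) {f : ℂ → ℂ} (hf : ContinuousOn f (G.subdrawing X F))
    (h0 : ∀ z ∈ G.subdrawing X F, f z ≠ 0)
    (hC : ∀ C : G.Cycle, (∀ i, C.edge i ∈ F) → HasLog C.carrier f) :
    HasLog (G.subdrawing X F) f := by
  induction F, toFinite F using Set.Finite.induction_on with
  | empty =>
    refine ⟨fun z => Complex.log (f z), ?_, fun z hz => Complex.exp_log (h0 z hz)⟩
    -- On finitely many points every function is continuous, including the principal logarithm.
    have hfin : (G.subdrawing X ∅).Finite := by
      simp only [subdrawing, mem_empty_iff_false, iUnion_of_empty, iUnion_empty, union_empty]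
      exact toFinite _
    exact hfin.continuousOn _
  | @insert e F heF _ ih =>
    have hsub : G.subdrawing X F ⊆ G.subdrawing X (insert e F) := by
      rw [subdrawing_insert]; exact subset_union_left
    have hsub' : range (G.arc e) ⊆ G.subdrawing X (insert e F) := by
      rw [subdrawing_insert]; exact subset_union_right
    have hF' : F ⊆ G.inducedEdges X := (subset_insert _ _).trans hF
    have hlog := ih hF' (hf.mono hsub) (fun z hz => h0 z (hsub hz))
      (fun C h => hC C fun i => mem_insert_of_mem _ (h i))
    by_cases hr : (G.edgeGraph F).Reachable (G.src e) (G.tgt e)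
    · exact hasLog_insert_of_reachable heF hF' hlog hC hr
    · exact hasLog_insert_of_not_reachable hF'
        (hasLog_range_arc e (hf.mono hsub') fun z hz => h0 z (hsub' hz)) hlog hr

/-- If an induced subgraph of a plane graph separates two points of the plane, then so does one of
its cycles. -/
theorem exists_cycle_separating [Finite V] [Finite E] {X : Set V} {z w : ℂ}
    (hz : z ∉ G.inducedDrawing X) (hw : w ∉ G.inducedDrawing X)
    (h : w ∉ connectedComponentIn (G.inducedDrawing X)ᶜ z) :
    ∃ C : G.Cycle, (∀ i, C.edge i ∈ G.inducedEdges X) ∧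
      w ∉ connectedComponentIn C.carrierᶜ z := by
  by_contra! hcon
  have hne : ∀ y ∉ G.inducedDrawing X, ∀ x ∈ G.inducedDrawing X, x - y ≠ 0 := fun y hy x hx =>
    sub_ne_zero.2 fun e => hy (e ▸ hx)
  refine h (mem_connectedComponentIn_of_hasLog (isCompact_inducedDrawing X) hz hw
    (hasLog_subdrawing subset_rfl (ContinuousOn.div (by fun_prop) (by fun_prop) (hne z hz))
      (fun x hx => div_ne_zero (hne w hw x hx) (hne z hz x hx)) fun C hC => ?_))
  exact hasLog_of_mem_connectedComponentIn C.isCompact_carrier.isClosed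
    (fun h => hz (Cycle.carrier_subset hC h)) (hcon C hC)
-- Distance layers and concentric cycles
-- This is the case `X = ∅` of the comparison with plane components, the plane being connected. It
-- ensures that `dist` never takes its default value `0` for unreachable pairs.
theorem preconnected_radialCompletion [Finite V] [Finite E] :
    G.radialCompletion.Preconnected := by
  intro a b
  obtain ⟨z, hz⟩ := exists_represents a
  obtain ⟨w, hw⟩ := exists_represents b
  have hempty : G.inducedDrawing ∅ = ∅ := by
    simp [inducedDrawing, subdrawing, inducedEdges]
  obtain ⟨p, -⟩ := radialConn_of_mem_connectedComponentIn (X := ∅) (a := a) (b := b)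
    (by simp [hempty]) (by
      rw [hempty, compl_empty, connectedComponentIn_univ, PreconnectedSpace.connectedComponent_eq_univ]
      exact mem_univ w)
    (hz.labels fun _ _ => notMem_empty _) (hw.labels fun _ _ => notMem_empty _)
  exact ⟨p⟩

/-- The vertices of `G` at distance `2 i + 1` or `2 i + 2` from `v` in the radial completion. -/
def layer (G : PlaneGraph V E) (v : V ⊕ G.Face) (i : ℕ) : Set V :=
  {u | G.radialCompletion.dist v (Sum.inl u) = 2 * i + 1 ∨
    G.radialCompletion.dist v (Sum.inl u) = 2 * i + 2}

/-- A layer separates the vertices of smaller distance from those of larger distance. -/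
theorem not_radialConn_layer [Finite V] [Finite E] {v w : V ⊕ G.Face} {i : ℕ}
    (hw : 2 * i + 2 < G.radialCompletion.dist v w) : ¬ G.RadialConn (G.layer v i) v w := by
  rintro ⟨p, hp⟩
  -- Invariant of a walk avoiding the layer: the distance is at most `2i`, or it is `2i + 1` at a
  -- face. From such a face the next vertex is in `V`, at distance at most `2i + 2`; being off the
  -- layer, it is back at distance at most `2i`.
  suffices h : ∀ a b (p : G.radialCompletion.Walk a b),
      (∀ u, Sum.inl u ∈ p.support → u ∉ G.layer v i) →
      (G.radialCompletion.dist v a ≤ 2 * i ∨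
        (G.radialCompletion.dist v a = 2 * i + 1 ∧ ∃ f, a = Sum.inr f)) →
      G.radialCompletion.dist v b ≤ 2 * i + 1 by
    have := h v w p hp (Or.inl (by simp))
    omega
  intro a b p hp ha
  induction p with
  | nil => rcases ha with h | ⟨h, -⟩ <;> omega
  | @cons a c b hac p ih =>
    refine ih (fun u hu => hp u (by simp [hu])) ?_
    have hdist : G.radialCompletion.dist v c ≤ G.radialCompletion.dist v a + 1 := by
      have := preconnected_radialCompletion (G := G)
      have h := (SimpleGraph.Connected.mk (nonempty := ⟨v⟩) this).dist_triangle
        (u := v) (v := a) (w := c)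
      rwa [SimpleGraph.dist_eq_one_iff_adj.2 hac] at h
    rcases c with u | f
    · have hu : ¬ (_ ∨ _) := hp u (by simp)
      rw [not_or] at hu
      left
      omega
    · rcases ha with h | ⟨-, f', rfl⟩
      · by_cases h' : G.radialCompletion.dist v (Sum.inr f) ≤ 2 * i
        · exact Or.inl h'
        · exact Or.inr ⟨by omega, f, rfl⟩
      · exact hac.elim

/-- A vertex of small distance can be reached without meeting a layer. -/
theorem radialConn_layer [Finite V] [Finite E] {v w : V ⊕ G.Face} {i : ℕ}
    (hw : G.radialCompletion.dist v w ≤ 2 * i) : G.RadialConn (G.layer v i) v w := by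
  classical
  obtain ⟨p, hp⟩ := (preconnected_radialCompletion v w).exists_walk_length_eq_dist
  refine ⟨p, fun u hu hu' => ?_⟩
  have h1 := SimpleGraph.dist_le (p.takeUntil _ hu)
  have h2 := p.length_takeUntil_le_length hu
  rcases hu' with h | h <;> omega

/-- The vertices of a connected subgraph of the radial completion of large distance can be reached
from each other without meeting a layer. -/
theorem radialConn_layer_of_subgraph {v : V ⊕ G.Face} {R : G.radialCompletion.Subgraph}
    (hR : R.coe.Preconnected) {i : ℕ}
    (hd : ∀ w ∈ R.verts, 2 * i + 2 < G.radialCompletion.dist v w) {a b : V ⊕ G.Face}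
    (ha : a ∈ R.verts) (hb : b ∈ R.verts) : G.RadialConn (G.layer v i) a b := by
  obtain ⟨p⟩ := hR ⟨a, ha⟩ ⟨b, hb⟩
  refine ⟨p.map R.hom, fun u hu hu' => ?_⟩
  replace hu : Sum.inl u ∈ (p.map R.hom).support := hu
  rw [SimpleGraph.Walk.support_map, List.mem_map] at hu
  obtain ⟨x, -, hx⟩ := hu
  have := hd _ x.2
  rw [show (x : V ⊕ G.Face) = Sum.inl u from hx] at this
  rcases hu' with h | h <;> omega

/-- Off a cycle, the component of a vertex on the outer face is unbounded. -/
theorem OnOuterFace.not_isBounded {t : V} (ht : G.OnOuterFace t) {X : Set V} (htX : t ∉ X)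
    {C : G.Cycle} (hC : ∀ i, C.edge i ∈ G.inducedEdges X) :
    ¬ Bornology.IsBounded (connectedComponentIn C.carrierᶜ (G.pos t)) := by
  obtain ⟨f, hf, htf⟩ := ht
  obtain ⟨z, hz⟩ := f.nonempty
  refine fun hb => hf (hb.subset fun w hw => ?_)
  refine connectedComponentIn_mono _ (compl_subset_compl.2 (Cycle.carrier_subset hC)) ?_
  rw [← connectedComponentIn_eq (mem_connectedComponentIn_of_incident htf htX hz)]
  exact Represents.mem_connectedComponentIn_of_inr hz hw

/-- Layers that are separated from a vertex on the outer face contain concentric cycles. -/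
theorem exists_concentric [Finite V] [Finite E] (v : V ⊕ G.Face) {t : V} (ht : G.OnOuterFace t)
    {n : ℕ} (hn : 2 * n < G.radialCompletion.dist v (Sum.inl t)) :
    ∃ C : Fin n → G.Cycle, Concentric C ∧
      ∀ (i : Fin n) j, (C i).edge j ∈ G.inducedEdges (G.layer v i) := by
  obtain ⟨z, hz⟩ := exists_represents v
  have hv : ∀ i u, Sum.inl u = v → u ∉ G.layer v i := by
    rintro i u rfl (h | h) <;> simp at h
  have htl : ∀ i < n, t ∉ G.layer v i := by
    rintro i hi (h | h) <;> omega
  have hrt : G.Represents (G.pos t) (Sum.inl t) := rfl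
  have hex : ∀ i : Fin n, ∃ C : G.Cycle, (∀ j, C.edge j ∈ G.inducedEdges (G.layer v i)) ∧
      G.pos t ∉ connectedComponentIn C.carrierᶜ z := fun i => by
    have htl' : ∀ u, Sum.inl u = (Sum.inl t : V ⊕ G.Face) → u ∉ G.layer v i :=
      fun u hu => Sum.inl_injective hu ▸ htl i i.2
    refine exists_cycle_separating (hz.notMem (hv i)) (hrt.notMem htl') fun h => ?_
    exact not_radialConn_layer (by have := i.2; omega)
      (radialConn_of_mem_connectedComponentIn (hz.notMem (hv i)) h (hz.labels (hv i))
        (hrt.labels htl'))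
  choose C hC hCt using hex
  refine ⟨C, fun i j hij => ?_, hC⟩
  -- Only one component off `C j` is unbounded, and it is that of `t`.
  have hbdd : Bornology.IsBounded (connectedComponentIn (C j).carrierᶜ z) := by
    by_contra hb
    have htj := htl j j.2
    have := connectedComponentIn_eq_of_not_isBounded (C j).isCompact_carrier.isBounded hb
      (ht.not_isBounded htj (hC j))
    refine hCt j (this ▸ mem_connectedComponentIn fun h => ?_)
    exact htj (pos_mem_inducedDrawing_iff.1 (Cycle.carrier_subset (hC j) h))
  rintro _ hx
  obtain ⟨k, s, rfl⟩ := mem_iUnion.1 hx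
  -- Layer `i` has distances at most `2i + 2 = 2j`, so a shortest walk from `v` to an end of this
  -- edge avoids layer `j`.
  have hend : ∀ u, G.IsEnd ((C i).edge k) u → G.radialCompletion.dist v (Sum.inl u) ≤ 2 * j :=
    fun u hu => by rcases hu.mem_of_mem_inducedEdges (hC i k) with h | h <;> omega
  have hend' : ∀ u, G.IsEnd ((C i).edge k) u → u ∉ G.layer v j := fun u hu h => by
    have := hend u hu
    rcases h with h | h <;> omega
  have hsrc : G.IsEnd ((C i).edge k) (G.src ((C i).edge k)) := Or.inl rfl
  have h1 := (radialConn_layer (hend _ hsrc)).mem_connectedComponentIn hz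
    (w := G.pos (G.src ((C i).edge k))) rfl
  have h2 := arc_mem_connectedComponentIn hend' hsrc s
  rw [← connectedComponentIn_eq h1] at h2
  have h3 := connectedComponentIn_mono z
    (compl_subset_compl.2 (Cycle.carrier_subset (hC j))) h2
  exact ⟨connectedComponentIn_subset _ _ h3, connectedComponentIn_eq h3 ▸ hbdd⟩

end PlaneGraph

/-! ### Steiner trees and the contradiction -/

theorem PDPInstance.IsSteinerTree.mem_verts {V E : Type*} {I : PDPInstance V E}
    {R : I.graph.radialCompletion.Subgraph} (hR : I.IsSteinerTree R) {u : V}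
    (hu : u ∈ I.terminals) : Sum.inl u ∈ R.verts := by
  have h : (Sum.inl u : V ⊕ I.graph.Face) ∈ {x | (R.neighborSet x).encard = 1} := by
    rw [hR.2]
    exact mem_image_of_mem _ hu
  obtain ⟨y, hy⟩ := encard_eq_one.1 (show (R.neighborSet (Sum.inl u)).encard = 1 from h)
  have : y ∈ R.neighborSet (Sum.inl u) := hy ▸ mem_singleton y
  exact R.edge_vert this

theorem mainTheorem8 {V E : Type*} [Finite V] [Finite E] (c : ℝ) (hc : 1 ≤ c)
    (I : PDPInstance V E) (hI : I.IsGood c)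
    (R : I.graph.radialCompletion.Subgraph) (hR : I.IsSteinerTree R)
    (v : V ⊕ I.graph.Face) :
    ∃ w ∈ R.verts, I.graph.radialCompletion.Reachable v w ∧
      (I.graph.radialCompletion.dist v w : ℝ) ≤ alphaDist c I.k := by
  by_contra! hcon
  obtain ⟨t, htT, ht, -⟩ := hI.outer
  set B : ℝ := 2 ^ (c * I.k) with hB
  have hB1 : 1 ≤ B := Real.one_le_rpow one_le_two (by positivity)
  set N := ⌊B⌋₊ with hN
  have hN1 : 1 ≤ N := Nat.le_floor (by simpa using hB1)
  have hNB : (N : ℝ) ≤ B := Nat.floor_le (by linarith)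
  have hBN : B < N + 1 := Nat.lt_floor_add_one B
  -- `4N ≥ 2N + 2` since `N ≥ 1`; thus the tree lies beyond the `N + 1` layers `0, …, N`.
  have hd : ∀ w ∈ R.verts, 2 * N + 2 < I.graph.radialCompletion.dist v w := fun w hw => by
    have h := hcon w hw (PlaneGraph.preconnected_radialCompletion v w)
    have h' : ((4 * N : ℕ) : ℝ) < I.graph.radialCompletion.dist v w := by
      refine lt_of_le_of_lt ?_ h
      rw [alphaDist, ← hB]
      push_cast
      linarith
    have := Nat.cast_lt.1 h'
    omega
  have htR := hR.mem_verts (show t ∈ I.terminals from Or.inr htT)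
  obtain ⟨C, hconc, hC⟩ := PlaneGraph.exists_concentric v ht (n := N + 1)
    (by have := hd _ htR; omega)
  have hfree : PlaneGraph.IsFree I.terminals C := by
    intro i hi u hu hint
    have hiN : (i : ℕ) = N := by omega
    -- The tree joins `t` to `u` off the last layer, so `u` shares the unbounded side of `t`.
    have hconn := PlaneGraph.radialConn_layer_of_subgraph (v := v) hR.1.1.preconnected (i := i)
      (by rw [hiN]; exact hd) htR (hR.mem_verts hu)
    have hmem := connectedComponentIn_mono (I.graph.pos t)
      (compl_subset_compl.2 (PlaneGraph.Cycle.carrier_subset (hC i)))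
      (hconn.mem_connectedComponentIn (z := I.graph.pos t) (w := I.graph.pos u) rfl rfl)
    refine ht.not_isBounded ?_ (hC i) (connectedComponentIn_eq hmem ▸ hint.2)
    have := hd _ htR
    rintro (h | h) <;> omega
  have := hI.concentric_le (N + 1) C hconc hfree
  push_cast at this
  linarith
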